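/- **Setting.** Let $\Omega\subset\mathbb R^d$ be compact and convex and let $\mathcal P(\Omega)$ be the set of Borel probability measures on $\Omega$. For $\mu,\nu\in\mathcal P(\Omega)$ let $$\mathrm W(\mu,\nu)=\Big(\inf_{\pi}\int |x-y|^2\,\mathrm d\pi(x,y)\Big)^{1/2},$$ where $\pi$ ranges over all couplings of $\mu$ and $\nu$. For a curve $\rho:[0,1]\to\mathcal P(\Omega)$ that is Lipschitz with respect to $\mathrm W$, let $\mathrm{energy}(\rho)$ be the infimum of $\int_0^1\|v(t)\|^2_{L^2(\rho(t))}\,\mathrm dt$ over all measurable families $v(t)\in L^2(\rho(t);\mathbb R^d)$, $t\in[0,1]$, such that for all $\phi\in C^1([0,1]\times\Omega)$ $$\int_0^1\!\!\int\partial_t\phi(t,\cdot)\,\mathrm d\rho(t)\,\mathrm dt+\int_0^1\!\!\int\langle\nabla\phi(t,\cdot),v(t)\rangle\,\mathrm d\rho(t)\,\mathrm dt=\int\phi(1,\cdot)\,\mathrm d\rho(1)-\int\phi(0,\cdot)\,\mathrm d\rho(0).$$ **Assumptions.** (i) $\mathcal S$ is a compact connected $m$-dimensional smooth Riemannian manifold,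 or, more generally, a compact connected geodesically convex subset of an $m$-dimensional smooth Riemannian manifold without boundary; norm $\|\cdot\|_\theta$, exponential map and distance $d_{\mathcal S}$ are those of the manifold. $\mathcal D$ is a set of tangent vectors $(\theta,\eta)$, $\theta\in\mathcal S$, on which $\exp$ is defined, such that $(\theta,\eta)\in\mathcal D$ implies $(\theta,t\eta)\in\mathcal D$ for $t\in[0,1]$, and such that for $(\theta,\eta)\in\mathcal D$ the curve $\gamma(t)=\exp_\theta(t\eta)$, $t\in[0,1]$, is a geodesic in $\mathcal S$ from $\theta$ to $\exp_\theta(\eta)$ with $\|\dot\gamma(t)\|_{\gamma(t)}=\|\eta\|_\theta=d_{\mathcal S}(\theta,\exp_\theta(\eta))$. For all $\theta_0,\theta_1\in\mathcal S$ there is $\eta$ with $(\theta_0,\eta)\in\mathcal D$ and $\exp_{\theta_0}(\eta)=\theta_1$. (ii) $E:\mathcal S\to\mathcal P(\Omega)$ is bi-Lipschitz onto its image $\Lambda=E(\mathcal S)$ with respect to $d_{\mathcal S}$ and $\mathrm W$, and every $E(\theta)$ is absolutely continuous with respect to Lebesgue measure. (iii) For each $\theta\in\mathcal S$, $B_\theta$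 is a linear map from $T_\theta\mathcal S$ to the $C^1$ gradient vector fields on $\mathbb R^d$. There is a constant $c\in(0,\infty)$ such that for all $(\theta,\eta)\in\mathcal D$, $x\in\mathbb R^d$, $t\in[0,1]$, with $\gamma(t)=\exp_\theta(t\eta)$, $$\tfrac1c\|\eta\|_\theta\le\|B_\theta\eta\|_{L^2(E(\theta))}\le c\|\eta\|_\theta,\qquad \|B_\theta\eta\|_{C^1(\mathbb R^d)}\le c\|\eta\|_\theta,\qquad \big|\partial_t[B_{\gamma(t)}\dot\gamma(t)](x)\big|\le c\|\eta\|_\theta^2 .$$ (iv) For every Lipschitz curve $\gamma:[0,1]\to\mathcal S$ and the flow $\varphi:[0,1]\times\Omega\to\mathbb R^d$ with $\varphi(0,\cdot)=\mathrm{id}$ and $\partial_t\varphi(t,\cdot)=[B_{\gamma(t)}\dot\gamma(t)](\varphi(t,\cdot))$ for a.e. $t$, one has $E(\gamma(t))=\varphi(t,\cdot)_\#E(\gamma(0))$ for all $t\in[0,1]$. For $\mu,\nu\in\Lambda$ let $$\mathrm W_\Lambda(\mu,\nu)=\inf\big\{\mathrm{energy}(\rho)^{1/2}\ :\ \rho:[0,1]\to\Lambda\text{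 Lipschitz with respect to }\mathrm W,\ \rho(0)=\mu,\ \rho(1)=\nu\big\}.$$ **Proposition.** Under these assumptions there is a constant $C\in(0,\infty)$ such that for all $\lambda_0,\lambda_1\in\Lambda$ with $\lambda_0\ne\lambda_1$ one has $0<\mathrm W(\lambda_0,\lambda_1)<\infty$, $\mathrm W_\Lambda(\lambda_0,\lambda_1)<\infty$ and $$0\le\frac{\mathrm W_\Lambda(\lambda_0,\lambda_1)-\mathrm W(\lambda_0,\lambda_1)}{\mathrm W(\lambda_0,\lambda_1)^2}\le C .$$ -/

import Mathlib

open Set MeasureTheory Bundle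
open scoped ENNReal NNReal Manifold ContDiff

noncomputable section

namespace WassersteinSubmanifold

/-- Euclidean space of dimension `d`. -/
abbrev Euc (d : ℕ) : Type := EuclideanSpace ℝ (Fin d)

/-! ### Wasserstein distance, continuity equation, energy, geodesic restriction

Probability measures on `Ω ⊆ ℝ^d` are measures on `ℝ^d` that are concentrated on `Ω`. -/

section Transport

variable {d : ℕ}

/-- The Wasserstein-2 distance: the square root of the infimal quadratic cost among all transport
plans. -/
def W (μ ν : Measure (Euc d)) : ℝ≥0∞ :=
  (⨅ (p : Measure (Euc d × Euc d)) (_ : p.fst = μ ∧ p.snd = ν),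
    ∫⁻ z, ‖z.1 - z.2‖ₑ ^ 2 ∂p) ^ (1 / 2 : ℝ)

/-- `v` is a measurable family of velocity fields `v t ∈ L²(ρ t; ℝ^d)`, `t ∈ [0,1]`, that satisfies
the continuity equation with the curve `ρ` in the distributional sense. -/
structure IsContinuityEq (ρ : ℝ → Measure (Euc d)) (v : ℝ → Euc d → Euc d) : Prop where
  measurable : Measurable (Function.uncurry v)
  memLp : ∀ t ∈ Icc (0 : ℝ) 1, MemLp (v t) 2 (ρ t)
  continuity : ∀ φ : ℝ × Euc d → ℝ, ContDiff ℝ 1 φ →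
    (∫ t in (0 : ℝ)..1, ∫ x, fderiv ℝ φ (t, x) (1, 0) ∂(ρ t)) +
      (∫ t in (0 : ℝ)..1, ∫ x, fderiv ℝ φ (t, x) (0, v t x) ∂(ρ t)) =
    (∫ x, φ (1, x) ∂(ρ 1)) - ∫ x, φ (0, x) ∂(ρ 0)

/-- The energy of a curve of measures: the infimum of `∫₀¹ ‖v(t)‖²_{L²(ρ(t))} dt` among the
velocity fields that satisfy the continuity equation. -/
def energy (ρ : ℝ → Measure (Euc d)) : ℝ≥0∞ :=
  ⨅ (v : ℝ → Euc d → Euc d) (_ : IsContinuityEq ρ v),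
    ∫⁻ t in Icc (0 : ℝ) 1, ∫⁻ x, ‖v t x‖ₑ ^ 2 ∂(ρ t)

/-- `ρ ∈ Lip([0,1]; (Λ, W))` with `ρ 0 = μ` and `ρ 1 = ν`. -/
structure IsLipCurve (Λ : Set (Measure (Euc d))) (μ ν : Measure (Euc d))
    (ρ : ℝ → Measure (Euc d)) : Prop where
  mem : ∀ t ∈ Icc (0 : ℝ) 1, ρ t ∈ Λ
  lipschitz : ∃ K : ℝ≥0, ∀ s ∈ Icc (0 : ℝ) 1, ∀ t ∈ Icc (0 : ℝ) 1,
    W (ρ s) (ρ t) ≤ K * edist s t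
  source : ρ 0 = μ
  target : ρ 1 = ν

/-- The geodesic restriction of `W` to `Λ`. -/
def WRestr (Λ : Set (Measure (Euc d))) (μ ν : Measure (Euc d)) : ℝ≥0∞ :=
  ⨅ (ρ : ℝ → Measure (Euc d)) (_ : IsLipCurve Λ μ ν ρ), energy ρ ^ (1 / 2 : ℝ)

end Transport

/-! ### Geodesics and the exponential map of a Riemannian manifold -/

section Riemannian

variable {m : ℕ} {M : Type*} [TopologicalSpace M] [ChartedSpace (Euc m) M]

/-- The velocity `γ'(t)` of a curve `γ : [0,1] → M` (one-sided at the end points). -/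
def velocity (γ : ℝ → M) (t : ℝ) : TangentSpace (𝓡 m) (γ t) :=
  mfderivWithin 𝓘(ℝ, ℝ) (𝓡 m) γ (Icc 0 1) t (1 : ℝ)

variable [IsManifold (𝓡 m) ∞ M] [RiemannianBundle (fun x : M ↦ TangentSpace (𝓡 m) x)]

/-- The Riemannian metric in the chart centred at `p`, evaluated at the point of the manifold with
coordinates `y`, on two coordinate vectors `u` and `w`. -/
def chartMetric (p : M) (y u w : Euc m) : ℝ :=
  inner ℝ (mfderiv 𝓘(ℝ, Euc m) (𝓡 m) (extChartAt (𝓡 m) p).symm y u)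
    (mfderiv 𝓘(ℝ, Euc m) (𝓡 m) (extChartAt (𝓡 m) p).symm y w)

/-- The Christoffel symbols of the first kind in the chart centred at `p`, as a trilinear form:
`Γ(u, v; w) = (∂_u g(v, w) + ∂_v g(u, w) - ∂_w g(u, v)) / 2`. -/
def christoffel (p : M) (y u v w : Euc m) : ℝ :=
  (fderiv ℝ (fun z ↦ chartMetric p z v w) y u + fderiv ℝ (fun z ↦ chartMetric p z u w) y v
    - fderiv ℝ (fun z ↦ chartMetric p z u v) y w) / 2

/-- `γ : [0,1] → M` is the geodesic with `γ(0) = θ` and `γ'(0) = η`: a `C²` curve that satisfies,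
at each time `t` and in the chart centred at `γ t`, the geodesic equation `c'' + Γ(c', c') = 0`
(with the index lowered by the metric). -/
structure IsGeodesicFrom (θ : M) (η : TangentSpace (𝓡 m) θ) (γ : ℝ → M) : Prop where
  contMDiffOn : ContMDiffOn 𝓘(ℝ, ℝ) (𝓡 m) 2 γ (Icc 0 1)
  geodesicEq : ∀ t ∈ Icc (0 : ℝ) 1, ∀ w : Euc m,
    let c : ℝ → Euc m := fun s ↦ extChartAt (𝓡 m) (γ t) (γ s)
    let c' : Euc m := derivWithin c (Icc 0 1) t
    let c'' : Euc m := iteratedDerivWithin 2 c (Icc 0 1) t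
    chartMetric (γ t) (c t) c'' w + christoffel (γ t) (c t) c' c' w = 0
  initial : (⟨γ 0, velocity γ 0⟩ : TangentBundle (𝓡 m) M) = ⟨θ, η⟩

open Classical in
/-- The Riemannian exponential map `exp_θ(η) = γ(1)`, where `γ` is the geodesic with `γ(0) = θ` and
`γ'(0) = η` (and the junk value `θ` if there is no such geodesic up to time `1`). -/
def riemExp (θ : M) (η : TangentSpace (𝓡 m) θ) : M :=
  if h : ∃ γ : ℝ → M, IsGeodesicFrom θ η γ then h.choose 1 else θ

/-- The curve `t ↦ exp_θ(t η)`. -/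
def expCurve (θ : M) (η : TangentSpace (𝓡 m) θ) (t : ℝ) : M := riemExp θ (t • η)

end Riemannian

/-! ### Parametrized submanifolds of the Wasserstein space -/

section Submanifold

variable {d : ℕ}

/-- `φ : [0,1] × Ω → ℝ^d` is a flow of the time dependent vector field `v`: it is continuous in
space, absolutely continuous in time, `φ(0, ·) = id`, and `∂ₜφ(t, ·) = v(t, φ(t, ·))` on `Ω` for
a.e. `t`. -/
structure IsFlow (Ω : Set (Euc d)) (v : ℝ → Euc d → Euc d) (φ : ℝ → Euc d → Euc d) : Prop where
  continuousOn : ∀ t ∈ Icc (0 : ℝ) 1, ContinuousOn (φ t) Ω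
  absCont : ∀ x ∈ Ω, AbsolutelyContinuousOnInterval (fun t ↦ φ t x) 0 1
  initial : ∀ x ∈ Ω, φ 0 x = x
  ode : ∀ᵐ t ∂(volume.restrict (Icc (0 : ℝ) 1)), ∀ x ∈ Ω,
    HasDerivAt (fun s ↦ φ s x) (v t (φ t x)) t

variable {m : ℕ} {M : Type*} [EMetricSpace M] [ChartedSpace (Euc m) M] [IsManifold (𝓡 m) ∞ M]
  [RiemannianBundle (fun x : M ↦ TangentSpace (𝓡 m) x)]

/-- The velocity field `v(t, ·) = B_{γ(t)} γ'(t)` induced by a curve `γ : [0,1] → M`. -/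
def velField (B : ∀ θ : M, TangentSpace (𝓡 m) θ →ₗ[ℝ] (Euc d → Euc d)) (γ : ℝ → M)
    (t : ℝ) : Euc d → Euc d :=
  B (γ t) (velocity γ t)

/-- The standing assumptions on a parametrized submanifold `Λ = E(S)` of the Wasserstein space over
`Ω`. The parameter manifold `S` is a compact, connected, geodesically convex subset of an
`m`-dimensional smooth Riemannian manifold `M` without boundary (`S = M` if `S` itself has no
boundary), so that its tangent spaces, norm, exponential map and distance are those of `M`. The
data `D`, `E`, `B` matter over `S` only. -/
structure MainAssumption (Ω : Set (Euc d)) (S : Set M) (D : ∀ θ : M, Set (TangentSpace (𝓡 m) θ))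
    (E : M → Measure (Euc d)) (B : ∀ θ : M, TangentSpace (𝓡 m) θ →ₗ[ℝ] (Euc d → Euc d)) :
    Prop where
  /- the domain -/
  isCompact_domain : IsCompact Ω
  convex_domain : Convex ℝ Ω
  /- (i) the parameter manifold and the domain `D` of the exponential map -/
  isCompact : IsCompact S
  isConnected : IsConnected S
  smul_mem : ∀ θ ∈ S, ∀ η ∈ D θ, ∀ t ∈ Icc (0 : ℝ) 1, t • η ∈ D θ
  geodesic : ∀ θ ∈ S, ∀ η ∈ D θ, IsGeodesicFrom θ η (expCurve θ η)
  geodesic_mem : ∀ θ ∈ S, ∀ η ∈ D θ, ∀ t ∈ Icc (0 : ℝ) 1, expCurve θ η t ∈ S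
  speed : ∀ θ ∈ S, ∀ η ∈ D θ, ∀ t ∈ Icc (0 : ℝ) 1, ‖velocity (m := m) (expCurve θ η) t‖ = ‖η‖
  minimizing : ∀ θ ∈ S, ∀ η ∈ D θ, edist θ (riemExp θ η) = ‖η‖ₑ
  exists_geodesic : ∀ θ₀ ∈ S, ∀ θ₁ ∈ S, ∃ η ∈ D θ₀, riemExp θ₀ η = θ₁
  /- (ii) the embedding -/
  isProbabilityMeasure : ∀ θ ∈ S, IsProbabilityMeasure (E θ)
  concentrated : ∀ θ ∈ S, E θ Ωᶜ = 0
  absolutelyContinuous : ∀ θ ∈ S, E θ ≪ volume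
  biLipschitz : ∃ L : ℝ≥0, ∀ θ₀ ∈ S, ∀ θ₁ ∈ S,
    W (E θ₀) (E θ₁) ≤ L * edist θ₀ θ₁ ∧ edist θ₀ θ₁ ≤ L * W (E θ₀) (E θ₁)
  /- (iii) the velocity fields -/
  contDiff : ∀ θ ∈ S, ∀ η : TangentSpace (𝓡 m) θ, ContDiff ℝ 1 (B θ η)
  gradient : ∀ θ ∈ S, ∀ η : TangentSpace (𝓡 m) θ,
    ∃ f : Euc d → ℝ, ∀ x, HasGradientAt f (B θ η x) x
  bounds : ∃ C : ℝ, 0 < C ∧ ∀ θ ∈ S, ∀ η ∈ D θ,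
    ENNReal.ofReal (1 / C * ‖η‖) ≤ eLpNorm (B θ η) 2 (E θ) ∧
    eLpNorm (B θ η) 2 (E θ) ≤ ENNReal.ofReal (C * ‖η‖) ∧
    (∀ x, ‖B θ η x‖ ≤ C * ‖η‖) ∧
    (∀ x, ‖fderiv ℝ (B θ η) x‖ ≤ C * ‖η‖) ∧
    ∀ x, ∀ t ∈ Icc (0 : ℝ) 1,
      DifferentiableWithinAt ℝ (fun s ↦ velField B (expCurve θ η) s x) (Icc 0 1) t ∧
      ‖derivWithin (fun s ↦ velField B (expCurve θ η) s x) (Icc 0 1) t‖ ≤ C * ‖η‖ ^ 2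
  /- (iv) consistency of the velocity fields with the embedding -/
  consistent : ∀ γ : ℝ → M, (∀ t ∈ Icc (0 : ℝ) 1, γ t ∈ S) →
    (∃ K : ℝ≥0, LipschitzOnWith K γ (Icc 0 1)) →
    ∀ φ : ℝ → Euc d → Euc d, IsFlow Ω (velField B γ) φ →
    ∀ t ∈ Icc (0 : ℝ) 1, E (γ t) = (E (γ 0)).map (φ t)

end Submanifold

end WassersteinSubmanifold

end

/-! Two estimates on squared distances carry the theorem.

Lower bound. `W ≤ WRestr` is the easy half of the Benamou–Brenier formula, obtained by duality
(`W_sq_le_lintegral`). If a `C¹` function `φ` satisfies `∂ₜφ + ⟨∇φ, p⟩ ≤ |p|²` for every `p`,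
testing the continuity equation with it bounds `∫ φ(1,·) dρ(1) - ∫ φ(0,·) dρ(0)` by the kinetic
energy. Hopf–Lax functions, made smooth by a soft minimum over a finite net, are such subsolutions.
They come arbitrarily close to any admissible Kantorovich pair, and Kantorovich duality
(`exists_coupling_integral_le`, from Hahn–Banach and Riesz) concludes.

Upper bound. Let `γ` be the geodesic from `θ` with initial velocity `η`, put `a = ‖η‖` and `g = B θ
η = ∇f`. The curve `E ∘ γ` is transported by the flow `Φ` of `B_γ γ'`, and along each trajectory
this field stays within `O(a²)` of `g` at the starting point. The energy is thus at most `∫ |g|² +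
O(a³)`, while `Φ 1 = id + g + O(a²)`. For small `a` the Lipschitz constant of `g` is small, so `id +
g` is the gradient of a convex function and hence optimal; its perturbation `Φ 1` is almost optimal
(`ofReal_le_W_sq_of_gradient`), which gives `W² ≥ ∫ |g|² - O(a³)`. Together `WRestr² ≤ W² + O(a³)`,
and `a ≤ L W` with division by `WRestr + W ≥ W` gives `WRestr - W = O(W²)`. If `a` is not small, `W`
is bounded below and the crude bound `WRestr = O(a)` suffices.

One geometric point needs care: the bounds on `B` hold on `D` only, so they must be transferred to
the velocities `γ' t` at later times. A geodesic in `D` from `γ t` to `γ 1` continues `γ` to a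
minimizing curve, which has no corner; hence its initial vector is `(1 - t) γ' t`
(`smul_velocity_mem`). -/

noncomputable section

open Filter Topology Manifold

namespace WassersteinSubmanifold

/-! ### Riemannian distance to first order, and curves without corners -/

section

variable {m : ℕ} {M : Type*} [EMetricSpace M] [ChartedSpace (Euc m) M]
    [IsManifold (𝓡 m) ∞ M] [RiemannianBundle (fun x : M ↦ TangentSpace (𝓡 m) x)]
    [IsContMDiffRiemannianBundle (𝓡 m) ∞ (Euc m) (fun x : M ↦ TangentSpace (𝓡 m) x)]

/-- The norm at `p` of the tangent vector whose coordinates in the chart at `p` are `w`. -/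
def metricNorm (p : M) (w : Euc m) : ℝ := norm (E := TangentSpace (𝓡 m) p) w

/-- Near `p`, the chart at `p` distorts the Riemannian metric by a factor arbitrarily close
to one. -/
theorem eventually_norm_mfderivWithin_symm_le (p : M) {r : ℝ} (hr : 1 < r) :
    ∀ᶠ y in 𝓝 (extChartAt (𝓡 m) p p), ∀ w : TangentSpace (𝓡 m) p,
      ‖mfderivWithin 𝓘(ℝ, Euc m) (𝓡 m) (extChartAt (𝓡 m) p).symm (range (𝓡 m)) y w‖ ≤ r * ‖w‖ := by
  have : IsContinuousRiemannianBundle (Euc m) (fun x : M ↦ TangentSpace (𝓡 m) x) := by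
    obtain ⟨g, hg, hgi⟩ := (inferInstance : IsContMDiffRiemannianBundle (𝓡 m) ∞ (Euc m)
      (fun x : M ↦ TangentSpace (𝓡 m) x)).exists_contMDiff
    exact ⟨g, hg.continuous, hgi⟩
  have h1 := eventually_norm_symmL_trivializationAt_comp_self_lt (Euc m)
    (fun x : M ↦ TangentSpace (𝓡 m) x) p hr
  have hq : 𝓝 p = 𝓝 ((extChartAt (𝓡 m) p).symm (extChartAt (𝓡 m) p p)) := by simp
  have hc : ContinuousAt (extChartAt (𝓡 m) p).symm (extChartAt (𝓡 m) p p) :=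
    continuousAt_extChartAt_symm _
  have h2 := h1.and (chart_source_mem_nhds (Euc m) p)
  rw [hq] at h2
  filter_upwards [hc.eventually h2, extChartAt_target_mem_nhds (I := 𝓡 m) p] with y hy hyt w
  obtain ⟨hy1, hy2⟩ := hy
  have h3 := ContinuousLinearMap.le_of_opNorm_le _ hy1.le w
  rw [ContinuousLinearMap.comp_apply, TangentBundle.symmL_trivializationAt hy2,
    TangentBundle.continuousLinearMapAt_trivializationAt (mem_chart_source _ p),
    mfderiv_extChartAt_self, (extChartAt (𝓡 m) p).right_inv hyt] at h3
  exact h3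

variable [IsRiemannianManifold (𝓡 m) M]

/-- Near `p`, the Riemannian distance is at most `r` times the distance in the chart at `p`,
measured with the metric at `p`, for any `r > 1`. -/
theorem eventually_edist_le_norm_extChartAt_sub (p : M) {r : ℝ} (hr : 1 < r) :
    ∀ᶠ z in 𝓝 p ×ˢ 𝓝 p, edist z.1 z.2 ≤ ENNReal.ofReal
      (r * metricNorm p (extChartAt (𝓡 m) p z.2 - extChartAt (𝓡 m) p z.1)) := by
  obtain ⟨ε, hε, hball⟩ := Metric.mem_nhds_iff.1 (inter_mem (extChartAt_target_mem_nhds (I := 𝓡 m) p)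
    (eventually_norm_mfderivWithin_symm_le p hr))
  have hA : ∀ᶠ x in 𝓝 p, x ∈ (extChartAt (𝓡 m) p).source ∧
      extChartAt (𝓡 m) p x ∈ Metric.ball (extChartAt (𝓡 m) p p) ε :=
    (eventually_mem_set.2 (extChartAt_source_mem_nhds p)).and
      ((continuousAt_extChartAt p).preimage_mem_nhds (Metric.ball_mem_nhds _ hε))
  filter_upwards [hA.prod_mk hA] with z ⟨⟨hx, hxb⟩, hy, hyb⟩
  set x := z.1
  set y := z.2
  -- The straight segment in the chart is a competitor for the distance, and its length is
  -- controlled by the distortion of the metric near `p`.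
  let l : ℝ → Euc m := AffineMap.lineMap (extChartAt (𝓡 m) p x) (extChartAt (𝓡 m) p y)
  have hl : ∀ t ∈ Icc (0 : ℝ) 1, l t ∈ Metric.ball (extChartAt (𝓡 m) p p) ε := fun t ht ↦
    (convex_ball _ _).segment_subset hxb hyb (by
      rw [segment_eq_image_lineMap]; exact mem_image_of_mem _ ht)
  have hld : ∀ t, HasDerivAt l (extChartAt (𝓡 m) p y - extChartAt (𝓡 m) p x) t := fun t ↦
    AffineMap.hasDerivAt_lineMap
  have hlc : ContDiff ℝ 1 l := by
    have : l = fun t : ℝ ↦ t • (extChartAt (𝓡 m) p y - extChartAt (𝓡 m) p x)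
        + extChartAt (𝓡 m) p x := by
      ext1 t; simp only [l, AffineMap.lineMap_apply_module']
    rw [this]; fun_prop
  have hlm : ContMDiffOn 𝓘(ℝ, ℝ) 𝓘(ℝ, Euc m) 1 l (Icc 0 1) := hlc.contMDiff.contMDiffOn
  have hmaps : MapsTo l (Icc 0 1) (extChartAt (𝓡 m) p).target := fun t ht ↦ (hball (hl t ht)).1
  have hle : edist x y ≤ pathELength (𝓡 m) ((extChartAt (𝓡 m) p).symm ∘ l) 0 1 := by
    rw [IsRiemannianManifold.out (I := 𝓡 m) x y]
    apply riemannianEDist_le_pathELength _ _ _ zero_le_one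
    · exact (contMDiffOn_extChartAt_symm p).comp hlm hmaps
    · simp [l, hx, -extChartAt]
    · simp [l, hy, -extChartAt]
  refine hle.trans ?_
  rw [pathELength_eq_lintegral_mfderivWithin_Icc]
  have hbound : ∀ t ∈ Icc (0 : ℝ) 1,
      ‖mfderivWithin 𝓘(ℝ, ℝ) (𝓡 m) ((extChartAt (𝓡 m) p).symm ∘ l) (Icc 0 1) t 1‖ₑ ≤
      ENNReal.ofReal (r * metricNorm p (extChartAt (𝓡 m) p y - extChartAt (𝓡 m) p x)) := by
    intro t ht
    have hcomp : mfderivWithin 𝓘(ℝ, ℝ) (𝓡 m) ((extChartAt (𝓡 m) p).symm ∘ l) (Icc 0 1) t =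
        (mfderivWithin 𝓘(ℝ, Euc m) (𝓡 m) (extChartAt (𝓡 m) p).symm (range (𝓡 m)) (l t)) ∘L
          (mfderivWithin 𝓘(ℝ, ℝ) 𝓘(ℝ, Euc m) l (Icc 0 1) t) := by
      apply mfderivWithin_comp
      · exact mdifferentiableWithinAt_extChartAt_symm (hmaps ht)
      · exact hlm.mdifferentiableOn one_ne_zero t ht
      · exact hmaps.mono_right (extChartAt_target_subset_range p)
      · rw [uniqueMDiffWithinAt_iff_uniqueDiffWithinAt]
        exact uniqueDiffOn_Icc zero_lt_one t ht
    have hd : mfderivWithin 𝓘(ℝ, ℝ) 𝓘(ℝ, Euc m) l (Icc 0 1) t (1 : ℝ) =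
        extChartAt (𝓡 m) p y - extChartAt (𝓡 m) p x := by
      rw [mfderivWithin_eq_fderivWithin]
      exact ((hld t).hasDerivWithinAt.derivWithin (uniqueDiffOn_Icc zero_lt_one t ht))
    have h2 := (hball (hl t ht)).2 (extChartAt (𝓡 m) p y - extChartAt (𝓡 m) p x)
    rw [← ofReal_norm]
    apply ENNReal.ofReal_le_ofReal
    rw [hcomp]
    refine le_trans (le_of_eq ?_) h2
    rw [← hd]
    rfl
  calc _ ≤ ∫⁻ t in Icc (0 : ℝ) 1,
          ENNReal.ofReal (r * metricNorm p (extChartAt (𝓡 m) p y - extChartAt (𝓡 m) p x)) :=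
        setLIntegral_mono' measurableSet_Icc hbound
    _ = _ := by simp

end

section

variable {m : ℕ} {M : Type*} [EMetricSpace M] [ChartedSpace (Euc m) M]
    [RiemannianBundle (fun x : M ↦ TangentSpace (𝓡 m) x)] [IsRiemannianManifold (𝓡 m) M]

/-- A `C¹` curve of constant speed `K` is `K`-Lipschitz. -/
theorem edist_le_of_norm_velocity_eq {γ : ℝ → M} (hγ : ContMDiffOn 𝓘(ℝ, ℝ) (𝓡 m) 1 γ (Icc 0 1))
    {K : ℝ} (hK : ∀ t ∈ Icc (0 : ℝ) 1, ‖velocity (m := m) γ t‖ = K) {s t : ℝ} (hs : 0 ≤ s)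
    (hst : s ≤ t) (ht : t ≤ 1) : edist (γ s) (γ t) ≤ ENNReal.ofReal (K * (t - s)) := by
  rw [IsRiemannianManifold.out (I := 𝓡 m) (γ s) (γ t)]
  refine (riemannianEDist_le_pathELength (hγ.mono (Icc_subset_Icc hs ht)) rfl rfl hst).trans ?_
  rw [pathELength_eq_lintegral_mfderiv_Ioo]
  have hb : ∀ u ∈ Ioo s t, ‖mfderiv 𝓘(ℝ, ℝ) (𝓡 m) γ u 1‖ₑ = ENNReal.ofReal K := by
    intro u hu
    rw [← mfderivWithin_of_mem_nhds (Icc_mem_nhds (hs.trans_lt hu.1) (hu.2.trans_le ht)),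
      ← ofReal_norm]
    congr 1
    exact hK u ⟨hs.trans hu.1.le, hu.2.le.trans ht⟩
  have hK0 : 0 ≤ K := by
    rw [← hK s ⟨hs, hst.trans ht⟩]; exact norm_nonneg _
  rw [setLIntegral_congr_fun measurableSet_Ioo hb]
  simp [ENNReal.ofReal_mul hK0]

end

section

variable {m : ℕ} {M : Type*} [EMetricSpace M] [ChartedSpace (Euc m) M]
    [RiemannianBundle (fun x : M ↦ TangentSpace (𝓡 m) x)]

theorem continuous_metricNorm (p : M) : Continuous (metricNorm (m := m) p) :=
  continuous_norm (E := TangentSpace (𝓡 m) p)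

theorem metricNorm_smul (p : M) (c : ℝ) (w : Euc m) :
    metricNorm p (c • w) = |c| * metricNorm p w :=
  norm_smul (α := ℝ) (β := TangentSpace (𝓡 m) p) c w

theorem metricNorm_nonneg (p : M) (w : Euc m) : 0 ≤ metricNorm p w :=
  norm_nonneg (E := TangentSpace (𝓡 m) p) w

/-- The equality case of the triangle inequality: by the parallelogram law `‖v - w‖² = 4K² - ‖v +
w‖² ≤ 0`. -/
theorem eq_of_metricNorm_le {p : M} {v w : Euc m} {K : ℝ} (hv : metricNorm p v = K)
    (hw : metricNorm p w = K) (h : 2 * K ≤ metricNorm p (v + w)) : v = w := by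
  let v' : TangentSpace (𝓡 m) p := v
  let w' : TangentSpace (𝓡 m) p := w
  have h1 : ‖v' + w'‖ ^ 2 + ‖v' - w'‖ ^ 2 = 2 * (‖v'‖ ^ 2 + ‖w'‖ ^ 2) :=
    parallelogram_law_with_norm ℝ v' w'
  have h2 : ‖v'‖ = K := hv
  have h3 : ‖w'‖ = K := hw
  have h4 : 2 * K ≤ ‖v' + w'‖ := h
  have h5 : ‖v' - w'‖ = 0 := by
    have := norm_nonneg (v' - w')
    have := norm_nonneg v'
    rw [h2, h3] at h1
    nlinarith
  have h6 : v' = w' := sub_eq_zero.1 (norm_eq_zero.1 h5)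
  exact h6

end

section

variable {m : ℕ} {M : Type*} [EMetricSpace M] [ChartedSpace (Euc m) M]

theorem hasDerivWithinAt_extChartAt_comp {γ : ℝ → M}
    (hγ : ContMDiffOn 𝓘(ℝ, ℝ) (𝓡 m) 1 γ (Icc 0 1)) {t : ℝ} (ht : t ∈ Icc (0 : ℝ) 1) :
    HasDerivWithinAt (fun s ↦ extChartAt (𝓡 m) (γ t) (γ s)) (velocity (m := m) γ t : Euc m)
      (Icc 0 1) t := by
  have h := ((hγ t ht).mdifferentiableWithinAt one_ne_zero).hasMFDerivWithinAt.2
  simp only [writtenInExtChartAt, mfld_simps] at h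
  let L : ℝ →L[ℝ] Euc m := mfderivWithin 𝓘(ℝ, ℝ) (𝓡 m) γ (Icc 0 1) t
  have h2 : HasFDerivWithinAt (fun s : ℝ ↦ (extChartAt (𝓡 m) (γ t) (γ s) : Euc m)) L
    (Icc 0 1) t := h
  exact h2.hasDerivWithinAt

theorem hasDerivWithinAt_extChartAt_comp_of_initial {γ : ℝ → M} {p : M}
    {ξ : TangentSpace (𝓡 m) p} (hγ : ContMDiffOn 𝓘(ℝ, ℝ) (𝓡 m) 1 γ (Icc 0 1))
    (h : (⟨γ 0, velocity γ 0⟩ : TangentBundle (𝓡 m) M) = ⟨p, ξ⟩) :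
    γ 0 = p ∧ HasDerivWithinAt (fun s ↦ extChartAt (𝓡 m) p (γ s)) (ξ : Euc m) (Icc 0 1) 0 := by
  have hp : γ 0 = p := congrArg TotalSpace.proj h
  subst hp
  have hξ : velocity γ 0 = ξ := eq_of_heq (TotalSpace.mk.inj h).2
  subst hξ
  exact ⟨rfl, hasDerivWithinAt_extChartAt_comp hγ ⟨le_rfl, zero_le_one⟩⟩

end

section

variable {m : ℕ} {M : Type*} [EMetricSpace M] [ChartedSpace (Euc m) M]
    [IsManifold (𝓡 m) ∞ M] [RiemannianBundle (fun x : M ↦ TangentSpace (𝓡 m) x)]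
    [IsContMDiffRiemannianBundle (𝓡 m) ∞ (Euc m) (fun x : M ↦ TangentSpace (𝓡 m) x)]
    [IsRiemannianManifold (𝓡 m) M]

/-- First-order upper bound for the distance between two curves that start at `p`. -/
theorem le_metricNorm_sub_of_le_edist {p : M} {c₁ c₂ : ℝ → M} {a b : Euc m} {K : ℝ}
    (h₁ : Tendsto c₁ (𝓝[>] 0) (𝓝 p)) (h₂ : Tendsto c₂ (𝓝[>] 0) (𝓝 p))
    (hd₁ : Tendsto (fun ε : ℝ ↦ ε⁻¹ • (extChartAt (𝓡 m) p (c₁ ε) - extChartAt (𝓡 m) p p))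
      (𝓝[>] 0) (𝓝 a))
    (hd₂ : Tendsto (fun ε : ℝ ↦ ε⁻¹ • (extChartAt (𝓡 m) p (c₂ ε) - extChartAt (𝓡 m) p p))
      (𝓝[>] 0) (𝓝 b))
    (hK : ∀ᶠ ε in 𝓝[>] (0 : ℝ), ENNReal.ofReal (K * ε) ≤ edist (c₁ ε) (c₂ ε)) :
    K ≤ metricNorm p (b - a) := by
  -- Near `p` the distance is Euclidean up to a factor `r`; dividing by `ε` gives the bound with
  -- `r`, and then `r` decreases to one.
  have key : ∀ r : ℝ, 1 < r → K ≤ r * metricNorm p (b - a) := by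
    intro r hr
    have hlim : Tendsto (fun ε : ℝ ↦ r * metricNorm p
        (ε⁻¹ • (extChartAt (𝓡 m) p (c₂ ε) - extChartAt (𝓡 m) p p) -
          ε⁻¹ • (extChartAt (𝓡 m) p (c₁ ε) - extChartAt (𝓡 m) p p)))
        (𝓝[>] 0) (𝓝 (r * metricNorm p (b - a))) :=
      (((continuous_metricNorm p).tendsto _).comp (hd₂.sub hd₁)).const_mul r
    refine ge_of_tendsto hlim ?_
    filter_upwards [hK, (h₁.prodMk h₂).eventually (eventually_edist_le_norm_extChartAt_sub (m := m) p hr),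
      self_mem_nhdsWithin] with ε h1 h2 hε
    have hε' : 0 < ε := hε
    have h3 := (ENNReal.ofReal_le_ofReal_iff
      (mul_nonneg (zero_le_one.trans hr.le) (metricNorm_nonneg _ _))).1 (h1.trans h2)
    rw [← smul_sub, sub_sub_sub_cancel_right, metricNorm_smul, abs_of_pos (inv_pos.2 hε'),
      mul_left_comm, inv_mul_eq_div, le_div_iff₀ hε']
    exact h3
  have hlim : Tendsto (fun r : ℝ ↦ r * metricNorm p (b - a)) (𝓝[>] 1)
      (𝓝 (1 * metricNorm p (b - a))) :=
    (tendsto_id.mono_left nhdsWithin_le_nhds).mul_const _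
  rw [one_mul] at hlim
  exact ge_of_tendsto hlim (by filter_upwards [self_mem_nhdsWithin] with r hr using key r hr)

end

section

variable {m : ℕ} {M : Type*} [EMetricSpace M] [ChartedSpace (Euc m) M]
    [IsManifold (𝓡 m) ∞ M] [RiemannianBundle (fun x : M ↦ TangentSpace (𝓡 m) x)]
    [IsContMDiffRiemannianBundle (𝓡 m) ∞ (Euc m) (fun x : M ↦ TangentSpace (𝓡 m) x)]
    [IsRiemannianManifold (𝓡 m) M]

/-- Step back from `γ t` along `γ` and forward along `σ`, with the time of `σ` rescaled so that both
have speed `K`. To first order the two points differ by `V + (1 - t)⁻¹ X`, whose norm is therefore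
at least `2K`. Both summands have norm `K`, so they coincide. -/
theorem eq_smul_of_le_edist {γ σ : ℝ → M} {t K : ℝ} (ht : t ∈ Ioo (0 : ℝ) 1) {V X : Euc m}
    (hder : HasDerivWithinAt (fun s ↦ extChartAt (𝓡 m) (γ t) (γ s)) V (Icc 0 1) t)
    (hγc : ContinuousWithinAt γ (Icc 0 1) t) (hσc : ContinuousWithinAt σ (Icc 0 1) 0)
    (hσ0 : σ 0 = γ t)
    (hderσ : HasDerivWithinAt (fun s ↦ extChartAt (𝓡 m) (γ t) (σ s)) X (Icc 0 1) 0)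
    (hV : metricNorm (γ t) V = K) (hX : metricNorm (γ t) X = (1 - t) * K)
    (hKle : ∀ᶠ ε in 𝓝[>] (0 : ℝ),
      ENNReal.ofReal (2 * K * ε) ≤ edist (γ (t - ε)) (σ ((1 - t)⁻¹ * ε))) :
    X = (1 - t) • V := by
  have ht1 : 0 < 1 - t := sub_pos.2 ht.2
  have hIcc : Icc (0 : ℝ) 1 ∈ 𝓝 t := Icc_mem_nhds ht.1 ht.2
  have hder' : HasDerivAt (fun s ↦ extChartAt (𝓡 m) (γ t) (γ s)) V t := hder.hasDerivAt hIcc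
  have hγc' : ContinuousAt γ t := hγc.continuousAt hIcc
  have hlin : Tendsto (fun ε : ℝ ↦ t - ε) (𝓝[>] 0) (𝓝 t) := by
    have : Continuous fun ε : ℝ ↦ t - ε := by fun_prop
    simpa using (this.tendsto 0).mono_left nhdsWithin_le_nhds
  have hsc : Tendsto (fun ε : ℝ ↦ (1 - t)⁻¹ * ε) (𝓝[>] 0) (𝓝[>] 0) := by
    refine tendsto_nhdsWithin_iff.2 ⟨?_, ?_⟩
    · have : Continuous fun ε : ℝ ↦ (1 - t)⁻¹ * ε := by fun_prop
      simpa using (this.tendsto 0).mono_left nhdsWithin_le_nhds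
    · filter_upwards [self_mem_nhdsWithin] with ε hε
      exact mul_pos (inv_pos.2 ht1) hε
  have hle : 𝓝[>] (0 : ℝ) ≤ 𝓝[Icc 0 1] 0 :=
    nhdsWithin_le_iff.2 (mem_of_superset (Ioo_mem_nhdsGT zero_lt_one) Ioo_subset_Icc_self)
  have hmain := le_metricNorm_sub_of_le_edist (p := γ t) (c₁ := fun ε ↦ γ (t - ε))
    (c₂ := fun ε ↦ σ ((1 - t)⁻¹ * ε)) (a := -V)
    (b := (1 - t)⁻¹ • X) (K := 2 * K) (hγc'.tendsto.comp hlin) ?_ ?_ ?_ hKle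
  · have : (1 - t)⁻¹ • X = V := by
      refine eq_of_metricNorm_le (p := γ t) (K := K) ?_ hV ?_
      · rw [metricNorm_smul, abs_of_pos (inv_pos.2 ht1), hX]
        field_simp
      · rwa [sub_neg_eq_add] at hmain
    rw [← this, smul_smul, mul_inv_cancel₀ ht1.ne', one_smul]
  · rw [← hσ0]
    exact (hσc.tendsto.mono_left hle).comp hsc
  · have h1 := (hasDerivAt_iff_tendsto_slope_zero.1 hder')
    have h2 : Tendsto (fun ε : ℝ ↦ -ε) (𝓝[>] 0) (𝓝[≠] 0) := by
      refine tendsto_nhdsWithin_iff.2 ⟨?_, ?_⟩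
      · have : Continuous fun ε : ℝ ↦ -ε := by fun_prop
        simpa using (this.tendsto 0).mono_left nhdsWithin_le_nhds
      · filter_upwards [self_mem_nhdsWithin] with ε hε
        exact neg_ne_zero.2 (ne_of_gt hε)
    have h3 := h1.comp h2
    refine (Tendsto.neg h3).congr fun ε ↦ ?_
    simp only [Function.comp_apply, inv_neg, neg_smul, neg_neg, sub_eq_add_neg]
  · have hmem : Icc (0 : ℝ) 1 ∈ 𝓝[>] (0 : ℝ) :=
      mem_of_superset (Ioo_mem_nhdsGT zero_lt_one) Ioo_subset_Icc_self
    have h0 : HasDerivWithinAt (fun s ↦ extChartAt (𝓡 m) (γ t) (σ s)) X (Ioi 0) 0 :=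
      HasDerivWithinAt.mono_of_mem_nhdsWithin hderσ hmem
    have h1 := (hasDerivWithinAt_iff_tendsto_slope' (self_notMem_Ioi)).1 h0
    have h2 := h1.comp hsc
    refine (Tendsto.const_smul h2 (1 - t)⁻¹).congr fun ε ↦ ?_
    simp only [Function.comp_apply, slope, vsub_eq_sub, sub_zero, hσ0, smul_smul]
    congr 1
    rw [mul_inv, inv_inv]
    field_simp

end

/-! ### Velocities of minimizing geodesics -/

namespace MainAssumption

variable {d m : ℕ} {M : Type*} [EMetricSpace M] [ChartedSpace (Euc m) M]
    [RiemannianBundle (fun x : M ↦ TangentSpace (𝓡 m) x)]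
    {Ω : Set (Euc d)} {S : Set M} {D : ∀ θ : M, Set (TangentSpace (𝓡 m) θ)}
    {E : M → Measure (Euc d)} {B : ∀ θ : M, TangentSpace (𝓡 m) θ →ₗ[ℝ] (Euc d → Euc d)}

theorem contMDiffOn_expCurve (h : MainAssumption Ω S D E B) {θ : M} (hθ : θ ∈ S)
    {η : TangentSpace (𝓡 m) θ} (hη : η ∈ D θ) :
    ContMDiffOn 𝓘(ℝ, ℝ) (𝓡 m) 1 (expCurve θ η) (Icc 0 1) :=
  (h.geodesic θ hθ η hη).contMDiffOn.of_le one_le_two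

theorem expCurve_zero (h : MainAssumption Ω S D E B) {θ : M} (hθ : θ ∈ S)
    {η : TangentSpace (𝓡 m) θ} (hη : η ∈ D θ) : expCurve θ η 0 = θ :=
  congrArg TotalSpace.proj (h.geodesic θ hθ η hη).initial

theorem expCurve_one (θ : M) (η : TangentSpace (𝓡 m) θ) : expCurve θ η 1 = riemExp θ η := by
  rw [expCurve, one_smul]

theorem edist_expCurve (h : MainAssumption Ω S D E B) {θ : M} (hθ : θ ∈ S)
    {η : TangentSpace (𝓡 m) θ} (hη : η ∈ D θ) {t : ℝ} (ht : t ∈ Icc (0 : ℝ) 1) :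
    edist θ (expCurve θ η t) = ENNReal.ofReal (‖η‖ * t) := by
  rw [expCurve, h.minimizing θ hθ _ (h.smul_mem θ hθ η hη t ht), ← ofReal_norm, norm_smul,
    Real.norm_of_nonneg ht.1, mul_comm]

variable [IsRiemannianManifold (𝓡 m) M]

theorem edist_expCurve_le (h : MainAssumption Ω S D E B) {θ : M} (hθ : θ ∈ S)
    {η : TangentSpace (𝓡 m) θ} (hη : η ∈ D θ) {s t : ℝ} (hs : 0 ≤ s) (hst : s ≤ t) (ht : t ≤ 1) :
    edist (expCurve θ η s) (expCurve θ η t) ≤ ENNReal.ofReal (‖η‖ * (t - s)) :=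
  edist_le_of_norm_velocity_eq (h.contMDiffOn_expCurve hθ hη) (h.speed θ hθ η hη) hs hst ht

variable [IsManifold (𝓡 m) ∞ M]
    [IsContMDiffRiemannianBundle (𝓡 m) ∞ (Euc m) (fun x : M ↦ TangentSpace (𝓡 m) x)]

/-- The velocity of a minimizing geodesic at an intermediate time is, up to scaling, again in the
domain of the exponential map: a minimizing curve has no corner. -/
theorem smul_velocity_mem (h : MainAssumption Ω S D E B) {θ : M} (hθ : θ ∈ S)
    {η : TangentSpace (𝓡 m) θ} (hη : η ∈ D θ) {t : ℝ} (ht : t ∈ Ioo (0 : ℝ) 1) :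
    (1 - t) • velocity (expCurve θ η) t ∈ D (expCurve θ η t) := by
  have ht' : t ∈ Icc (0 : ℝ) 1 := ⟨ht.1.le, ht.2.le⟩
  have ht1 : 0 < 1 - t := sub_pos.2 ht.2
  have h1S : expCurve θ η 1 ∈ S := h.geodesic_mem θ hθ η hη 1 ⟨zero_le_one, le_rfl⟩
  have hpS := h.geodesic_mem θ hθ η hη t ht'
  obtain ⟨ξ, hξ, hξ1⟩ := h.exists_geodesic _ hpS _ h1S
  have hcont := h.contMDiffOn_expCurve hθ hη
  have hcontσ := h.contMDiffOn_expCurve hpS hξ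
  have hstart := (h.geodesic _ hpS ξ hξ).initial
  have hspeed : ‖velocity (m := m) (expCurve θ η) t‖ = ‖η‖ := h.speed θ hθ η hη t ht'
  set K : ℝ := ‖η‖ with hKdef
  have hK0 : 0 ≤ K := norm_nonneg _
  have hd1 : edist θ (expCurve θ η 1) = ENNReal.ofReal K := by
    rw [h.edist_expCurve hθ hη ⟨zero_le_one, le_rfl⟩, mul_one]
  have hpd : edist (expCurve θ η t) (expCurve θ η 1) = ENNReal.ofReal ‖ξ‖ := by
    rw [ofReal_norm, ← h.minimizing _ hpS _ hξ, hξ1]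
  -- The point `γ t` has distance `t K` from the start, and the whole geodesic realizes the distance
  -- `K`; the triangle inequality leaves `(1 - t) K` for the rest.
  have hξn : ‖ξ‖ = (1 - t) * K := by
    apply le_antisymm
    · have := h.edist_expCurve_le hθ hη ht.1.le ht.2.le le_rfl
      rw [hpd, ENNReal.ofReal_le_ofReal_iff (by positivity)] at this
      linarith
    · have := edist_triangle θ (expCurve θ η t) (expCurve θ η 1)
      have htn := ht.1.le
      rw [hd1, hpd, h.edist_expCurve hθ hη ht', ← ENNReal.ofReal_add (by positivity)
        (norm_nonneg _), ENNReal.ofReal_le_ofReal_iff (by positivity)] at this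
      linarith
  have hσ1 : expCurve (expCurve θ η t) ξ 1 = expCurve θ η 1 := by rw [expCurve_one, hξ1]
  set σ := expCurve (expCurve θ η t) ξ with hσ
  have hσd : ∀ s ∈ Icc (0 : ℝ) 1, edist (σ s) (expCurve θ η 1) ≤
      ENNReal.ofReal ((1 - t) * K * (1 - s)) := by
    intro s hs
    have := h.edist_expCurve_le hpS hξ hs.1 hs.2 le_rfl
    rwa [← hσ, hσ1, hξn] at this
  have hder := hasDerivWithinAt_extChartAt_comp hcont ht'
  clear_value σ
  obtain ⟨hσ0, hderσ⟩ := hasDerivWithinAt_extChartAt_comp_of_initial hcontσ hstart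
  -- On the way from `θ` to the end point, the first leg has length `K (t - ε)` and the last at most
  -- `K (1 - t - ε)`. The total is at least `K`, which leaves `2 K ε` for the middle leg around the
  -- possible corner.
  have hKle : ∀ᶠ ε in 𝓝[>] (0 : ℝ),
      ENNReal.ofReal (2 * K * ε) ≤ edist (expCurve θ η (t - ε)) (σ ((1 - t)⁻¹ * ε)) := by
    filter_upwards [Ioo_mem_nhdsGT (lt_min ht.1 ht1)] with ε hε
    have hεt := hε.2.trans_le (min_le_left _ _)
    have hεt1 := hε.2.trans_le (min_le_right _ _)
    have hε0 := hε.1.le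
    have hs : (1 - t)⁻¹ * ε ∈ Icc (0 : ℝ) 1 := by
      refine ⟨by positivity, ?_⟩
      rw [inv_mul_eq_div, div_le_one ht1]; exact hεt1.le
    have h4 := edist_triangle4 θ (expCurve θ η (t - ε)) (σ ((1 - t)⁻¹ * ε)) (expCurve θ η 1)
    have h5 := h.edist_expCurve hθ hη (t := t - ε) ⟨by linarith, by linarith [ht.2]⟩
    rw [← hKdef] at h5
    rw [hd1, h5] at h4
    have hval : (1 - t) * K * (1 - (1 - t)⁻¹ * ε) = K * (1 - t - ε) := by
      field_simp
    have h6 := hσd _ hs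
    rw [hval] at h6
    have hA : 0 ≤ K * (t - ε) := mul_nonneg hK0 (by linarith)
    have hB : 0 ≤ K * (1 - t - ε) := mul_nonneg hK0 (by linarith)
    have hC : 0 ≤ 2 * K * ε := by positivity
    have h7 : ENNReal.ofReal (K * (t - ε)) + ENNReal.ofReal (2 * K * ε) +
        ENNReal.ofReal (K * (1 - t - ε)) ≤ ENNReal.ofReal (K * (t - ε)) +
        edist (expCurve θ η (t - ε)) (σ ((1 - t)⁻¹ * ε)) + ENNReal.ofReal (K * (1 - t - ε)) := by
      rw [← ENNReal.ofReal_add hA hC, ← ENNReal.ofReal_add (by positivity) hB]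
      refine le_trans (le_of_eq ?_) (h4.trans (by gcongr))
      congr 1; ring
    exact (ENNReal.add_le_add_iff_left ENNReal.ofReal_ne_top).1
      ((ENNReal.add_le_add_iff_right ENNReal.ofReal_ne_top).1 h7)
  have h8 : ξ = (1 - t) • velocity (m := m) (expCurve θ η) t :=
    eq_smul_of_le_edist ht hder ((hcont.continuousOn) t ht')
      (hcontσ.continuousOn 0 ⟨le_rfl, zero_le_one⟩) hσ0 hderσ hspeed hξn hKle
  rwa [← h8]

end MainAssumption

/-! ### Uniform bounds on the velocity fields along geodesics -/

namespace MainAssumption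

variable {d m : ℕ} {M : Type*} [EMetricSpace M] [ChartedSpace (Euc m) M]
    [RiemannianBundle (fun x : M ↦ TangentSpace (𝓡 m) x)]
    {Ω : Set (Euc d)} {S : Set M} {D : ∀ θ : M, Set (TangentSpace (𝓡 m) θ)}
    {E : M → Measure (Euc d)} {B : ∀ θ : M, TangentSpace (𝓡 m) θ →ₗ[ℝ] (Euc d → Euc d)}

theorem velField_expCurve_zero (h : MainAssumption Ω S D E B) {θ : M} (hθ : θ ∈ S)
    {η : TangentSpace (𝓡 m) θ} (hη : η ∈ D θ) : velField B (expCurve θ η) 0 = B θ η :=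
  congrArg (fun z : TangentBundle (𝓡 m) M ↦ B z.1 z.2) (h.geodesic θ hθ η hη).initial

variable [IsRiemannianManifold (𝓡 m) M] [IsManifold (𝓡 m) ∞ M]
    [IsContMDiffRiemannianBundle (𝓡 m) ∞ (Euc m) (fun x : M ↦ TangentSpace (𝓡 m) x)]

/-- The velocity fields along the geodesics are bounded and Lipschitz in space and in time, with
constants controlled by the length of the geodesic. -/
theorem exists_velField_bounds (h : MainAssumption Ω S D E B) :
    ∃ C : ℝ, 0 < C ∧ ∀ θ ∈ S, ∀ η ∈ D θ,
      (∀ t ∈ Icc (0 : ℝ) 1, ∀ x, ‖velField B (expCurve θ η) t x‖ ≤ C * ‖η‖) ∧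
      (∀ t ∈ Icc (0 : ℝ) 1, ∀ x y,
        ‖velField B (expCurve θ η) t x - velField B (expCurve θ η) t y‖ ≤ C * ‖η‖ * ‖x - y‖) ∧
      (∀ s ∈ Icc (0 : ℝ) 1, ∀ t ∈ Icc (0 : ℝ) 1, ∀ x,
        ‖velField B (expCurve θ η) s x - velField B (expCurve θ η) t x‖ ≤
          C * ‖η‖ ^ 2 * |s - t|) := by
  obtain ⟨C, hC, hb⟩ := h.bounds
  have hlip : ∀ θ ∈ S, ∀ η ∈ D θ, ∀ x y, ‖B θ η x - B θ η y‖ ≤ C * ‖η‖ * ‖x - y‖ := by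
    intro θ hθ η hη x y
    exact convex_univ.norm_image_sub_le_of_norm_fderiv_le (𝕜 := ℝ)
      (fun z _ ↦ ((h.contDiff θ hθ η).differentiable one_ne_zero) z)
      (fun z _ ↦ (hb θ hθ η hη).2.2.2.1 z) (mem_univ y) (mem_univ x)
  refine ⟨C, hC, fun θ hθ η hη ↦ ?_⟩
  have htime : ∀ s ∈ Icc (0 : ℝ) 1, ∀ t ∈ Icc (0 : ℝ) 1, ∀ x,
      ‖velField B (expCurve θ η) s x - velField B (expCurve θ η) t x‖ ≤
        C * ‖η‖ ^ 2 * |s - t| := by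
    intro s hs t ht x
    exact (convex_Icc (0 : ℝ) 1).norm_image_sub_le_of_norm_derivWithin_le (𝕜 := ℝ)
      (f := fun s ↦ velField B (expCurve θ η) s x)
      (fun u hu ↦ ((hb θ hθ η hη).2.2.2.2 x u hu).1)
      (fun u hu ↦ ((hb θ hθ η hη).2.2.2.2 x u hu).2) ht hs
  have hcont : ∀ x, Tendsto (fun s ↦ velField B (expCurve θ η) s x) (𝓝[Ico 0 1] 1)
      (𝓝 (velField B (expCurve θ η) 1 x)) := fun x ↦
    (((hb θ hθ η hη).2.2.2.2 x 1 ⟨zero_le_one, le_rfl⟩).1.continuousWithinAt.mono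
      Ico_subset_Icc_self)
  have hne : (𝓝[Ico (0 : ℝ) 1] 1).NeBot := by
    rw [← mem_closure_iff_nhdsWithin_neBot, closure_Ico zero_ne_one]
    exact ⟨zero_le_one, le_rfl⟩
  -- A positive multiple of `γ' t` lies in `D`, and since the bounds are homogeneous in the tangent
  -- vector, the factor cancels. At `t = 1` the multiple `1 - t` degenerates, so that time is
  -- reached as a limit, by continuity of the field in time.
  have hB : ∀ t ∈ Ico (0 : ℝ) 1, ∃ c : ℝ, 0 < c ∧ ∃ ζ ∈ D (expCurve θ η t), ‖ζ‖ = c * ‖η‖ ∧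
      B (expCurve θ η t) ζ = c • velField B (expCurve θ η) t := by
    intro t ht
    rcases ht.1.eq_or_lt with rfl | ht0
    · refine ⟨1, one_pos, velocity (expCurve θ η) 0, ?_, ?_, ?_⟩
      · have := (h.geodesic θ hθ η hη).initial
        have h2 : (fun z : TangentBundle (𝓡 m) M ↦ z.2 ∈ D z.1) ⟨θ, η⟩ := hη
        rw [← this] at h2
        exact h2
      · rw [one_mul]; exact h.speed θ hθ η hη 0 ⟨le_rfl, zero_le_one⟩
      · rw [one_smul]; rfl
    · refine ⟨1 - t, sub_pos.2 ht.2, _, h.smul_velocity_mem hθ hη ⟨ht0, ht.2⟩, ?_, ?_⟩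
      · rw [norm_smul, Real.norm_of_nonneg (sub_nonneg.2 ht.2.le),
          h.speed θ hθ η hη t ⟨ht.1, ht.2.le⟩]
      · rw [map_smul]; rfl
  have hbd : ∀ t ∈ Ico (0 : ℝ) 1, ∀ x, ‖velField B (expCurve θ η) t x‖ ≤ C * ‖η‖ := by
    intro t ht x
    obtain ⟨c, hc, ζ, hζ, hζn, hBζ⟩ := hB t ht
    have h1 := (hb _ (h.geodesic_mem θ hθ η hη t ⟨ht.1, ht.2.le⟩) ζ hζ).2.2.1 x
    rw [hBζ, Pi.smul_apply, norm_smul, Real.norm_of_nonneg hc.le, hζn] at h1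
    have : c * ‖velField B (expCurve θ η) t x‖ ≤ c * (C * ‖η‖) := by linarith
    exact le_of_mul_le_mul_left this hc
  have hlp : ∀ t ∈ Ico (0 : ℝ) 1, ∀ x y,
      ‖velField B (expCurve θ η) t x - velField B (expCurve θ η) t y‖ ≤ C * ‖η‖ * ‖x - y‖ := by
    intro t ht x y
    obtain ⟨c, hc, ζ, hζ, hζn, hBζ⟩ := hB t ht
    have h1 := hlip _ (h.geodesic_mem θ hθ η hη t ⟨ht.1, ht.2.le⟩) ζ hζ x y
    rw [hBζ, Pi.smul_apply, Pi.smul_apply, ← smul_sub, norm_smul, Real.norm_of_nonneg hc.le,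
      hζn] at h1
    have : c * ‖velField B (expCurve θ η) t x - velField B (expCurve θ η) t y‖ ≤
        c * (C * ‖η‖ * ‖x - y‖) := by linarith
    exact le_of_mul_le_mul_left this hc
  refine ⟨fun t ht x ↦ ?_, fun t ht x y ↦ ?_, htime⟩
  · rcases ht.2.eq_or_lt with rfl | ht1
    · exact le_of_tendsto (hcont x).norm
        (by filter_upwards [self_mem_nhdsWithin] with s hs using hbd s hs x)
    · exact hbd t ⟨ht.1, ht1⟩ x
  · rcases ht.2.eq_or_lt with rfl | ht1
    · exact le_of_tendsto ((hcont x).sub (hcont y)).norm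
        (by filter_upwards [self_mem_nhdsWithin] with s hs using hlp s hs x y)
    · exact hlp t ⟨ht.1, ht1⟩ x y

end MainAssumption

/-! ### Flows of bounded Lipschitz fields and the continuity equation -/

section Flow

variable {d : ℕ} {w : ℝ → Euc d → Euc d} {Φ : ℝ → Euc d → Euc d} {A K : ℝ≥0}

/-- A bounded continuous vector field that is Lipschitz in space has a continuous flow. -/
theorem exists_flow (hw : Continuous (Function.uncurry w)) (hA : ∀ t x, ‖w t x‖ ≤ A)
    (hK : ∀ t, LipschitzWith K (w t)) :
    ∃ Φ : ℝ → Euc d → Euc d, Continuous (Function.uncurry Φ) ∧ (∀ x, Φ 0 x = x) ∧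
      ∀ x, ∀ t ∈ Icc (0 : ℝ) 1, HasDerivWithinAt (fun s ↦ Φ s x) (w t (Φ t x)) (Icc 0 1) t := by
  have hex : ∀ x, ∃ α : ℝ → Euc d, α 0 = x ∧
      ∀ t ∈ Icc (0 : ℝ) 1, HasDerivWithinAt α (w t (α t)) (Icc 0 1) t := by
    intro x
    -- In unit time a field bounded by `A` moves a point by at most `A`, so a single Picard–Lindelöf
    -- step covers `[0,1]`.
    have hpl : IsPicardLindelof w (⟨0, le_rfl, zero_le_one⟩ : Icc (0 : ℝ) 1) x A 0 A K :=
      { lipschitzOnWith := fun t _ ↦ (hK t).lipschitzOnWith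
        continuousOn := fun y _ ↦ (hw.comp (by fun_prop : Continuous fun t : ℝ ↦ (t, y))).continuousOn
        norm_le := fun t _ y _ ↦ hA t y
        mul_max_le := by simp }
    exact hpl.exists_eq_forall_mem_Icc_hasDerivWithinAt₀
  choose α hα0 hα using hex
  have hcont : ∀ x, ContinuousOn (α x) (Icc 0 1) := fun x t ht ↦ (hα x t ht).continuousWithinAt
  have hright : ∀ x, ∀ t ∈ Ico (0 : ℝ) 1, HasDerivWithinAt (α x) (w t (α x t)) (Ici t) t := by
    intro x t ht
    exact (hα x t ⟨ht.1, ht.2.le⟩).mono_of_mem_nhdsWithin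
      (mem_of_superset (Icc_mem_nhdsGE ht.2) (Icc_subset_Icc_left ht.1))
  have hlip : ∀ t ∈ Icc (0 : ℝ) 1,
      LipschitzOnWith (Real.toNNReal (Real.exp K)) (fun x ↦ α x t) univ := by
    intro t ht
    refine LipschitzOnWith.of_dist_le_mul fun x _ y _ ↦ ?_
    have h1 := dist_le_of_trajectories_ODE hK (hcont x) (hright x) (hcont y) (hright y) le_rfl t ht
    rw [hα0, hα0] at h1
    rw [Real.coe_toNNReal _ (Real.exp_pos _).le, mul_comm]
    refine h1.trans ?_
    gcongr
    have : (K : ℝ) * (t - 0) ≤ K * 1 := by gcongr; linarith [ht.2]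
    simpa using this
  have hjoint : ContinuousOn (Function.uncurry α) (univ ×ˢ Icc 0 1) :=
    continuousOn_prod_of_continuousOn_lipschitzOnWith _ _ (fun x _ ↦ hcont x) hlip
  -- Clamping the time to `[0,1]` makes the flow continuous on all of `ℝ × ℝ^d`. Joint continuity
  -- comes from the Grönwall bound, uniform in time, on the dependence on the initial point.
  refine ⟨fun t x ↦ α x (projIcc 0 1 zero_le_one t), ?_, fun x ↦ ?_, fun x t ht ↦ ?_⟩
  · exact hjoint.comp_continuous (f := fun z : ℝ × Euc d ↦ (z.2, (projIcc 0 1 zero_le_one z.1 : ℝ)))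
      (by fun_prop) (fun z ↦ ⟨mem_univ _, (projIcc 0 1 zero_le_one z.1).2⟩)
  · simpa using hα0 x
  · have h1 : ∀ s ∈ Icc (0 : ℝ) 1, α x (projIcc 0 1 zero_le_one s) = α x s := fun s hs ↦ by
      rw [projIcc_of_mem _ hs]
    simp only [h1 t ht]
    exact (hα x t ht).congr_of_mem h1 ht

theorem norm_flow_sub_le (hA : ∀ t x, ‖w t x‖ ≤ A) {x : Euc d}
    (hΦ : ∀ t ∈ Icc (0 : ℝ) 1, HasDerivWithinAt (fun s ↦ Φ s x) (w t (Φ t x)) (Icc 0 1) t)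
    {s t : ℝ} (hs : s ∈ Icc (0 : ℝ) 1) (ht : t ∈ Icc (0 : ℝ) 1) :
    ‖Φ t x - Φ s x‖ ≤ A * ‖t - s‖ :=
  (convex_Icc (0 : ℝ) 1).norm_image_sub_le_of_norm_hasDerivWithin_le hΦ (fun u _ ↦ hA u _) hs ht

/-- The images of a measure under a flow solve the continuity equation. -/
theorem isContinuityEq_of_flow (hw : Continuous (Function.uncurry w)) (hA : ∀ t x, ‖w t x‖ ≤ A)
    (hΦc : Continuous (Function.uncurry Φ))
    (hΦ : ∀ x, ∀ t ∈ Icc (0 : ℝ) 1,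
      HasDerivWithinAt (fun s ↦ Φ s x) (w t (Φ t x)) (Icc 0 1) t)
    {Ω : Set (Euc d)} (hΩ : IsCompact Ω) {μ : Measure (Euc d)} [IsProbabilityMeasure μ]
    (hμ : μ Ωᶜ = 0) {ρ : ℝ → Measure (Euc d)} (hρ : ∀ t ∈ Icc (0 : ℝ) 1, ρ t = μ.map (Φ t)) :
    IsContinuityEq ρ w := by
  have hΦt : ∀ t, Continuous (Φ t) := fun t ↦ hΦc.comp (by fun_prop : Continuous fun x ↦ (t, x))
  have hwt : ∀ t, Continuous (w t) := fun t ↦ hw.comp (by fun_prop : Continuous fun x ↦ (t, x))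
  refine ⟨hw.measurable, fun t ht ↦ ?_, fun φ hφ ↦ ?_⟩
  · have : IsProbabilityMeasure (ρ t) := by
      rw [hρ t ht]; exact Measure.isProbabilityMeasure_map (hΦt t).aemeasurable
    exact MemLp.of_bound (hwt t).aestronglyMeasurable A (ae_of_all _ (hA t))
  · have hφd : Differentiable ℝ φ := hφ.differentiable one_ne_zero
    have hφc : Continuous (fderiv ℝ φ) := hφ.continuous_fderiv one_ne_zero
    have hμΩ : μ.restrict Ω = μ := Measure.restrict_eq_self_of_ae_mem hμ
    have hΦ1 : Continuous fun z : ℝ × Euc d ↦ Φ z.1 z.2 := hΦc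
    have hwΦ : Continuous fun z : ℝ × Euc d ↦ w z.1 (Φ z.1 z.2) :=
      hw.comp (by fun_prop : Continuous fun z : ℝ × Euc d ↦ (z.1, Φ z.1 z.2))
    have hD : Continuous fun z : ℝ × Euc d ↦ fderiv ℝ φ (z.1, Φ z.1 z.2) :=
      hφc.comp (by fun_prop)
    -- The product measure is concentrated on the compact set `[0,1] × Ω`, where continuous
    -- functions are bounded; this justifies Fubini below.
    have key : ∀ g : ℝ × Euc d → ℝ, Continuous g →
        Integrable g ((volume.restrict (uIoc (0 : ℝ) 1)).prod μ) := by
      intro g hg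
      obtain ⟨b, hb⟩ := (isCompact_Icc.prod hΩ).exists_bound_of_continuousOn
        (f := g) (s := Icc (0 : ℝ) 1 ×ˢ Ω) hg.continuousOn
      have : IsFiniteMeasure (volume.restrict (uIoc (0 : ℝ) 1)) := by
        rw [uIoc_of_le zero_le_one]; infer_instance
      refine Integrable.of_bound hg.aestronglyMeasurable b ?_
      rw [← hμΩ, Measure.prod_restrict]
      refine ae_restrict_of_forall_mem
        (measurableSet_uIoc.prod hΩ.measurableSet) fun z hz ↦ hb z ⟨?_, hz.2⟩
      have := hz.1
      rw [uIoc_of_le zero_le_one] at this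
      exact ⟨this.1.le, this.2⟩
    have key' : ∀ g : ℝ × Euc d → ℝ, Continuous g →
        Integrable (fun x ↦ ∫ t in (0 : ℝ)..1, g (t, x)) μ := by
      intro g hg
      have := (key g hg).integral_prod_right
      rw [uIoc_of_le zero_le_one] at this
      simpa only [intervalIntegral.integral_of_le zero_le_one] using this
    have hg₁ : Continuous fun z : ℝ × Euc d ↦ fderiv ℝ φ (z.1, Φ z.1 z.2) (1, 0) :=
      hD.clm_apply continuous_const
    have hg₂ : Continuous fun z : ℝ × Euc d ↦
        fderiv ℝ φ (z.1, Φ z.1 z.2) (0, w z.1 (Φ z.1 z.2)) :=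
      hD.clm_apply (by fun_prop)
    have e₁ : (∫ t in (0 : ℝ)..1, ∫ x, fderiv ℝ φ (t, x) (1, 0) ∂(ρ t)) =
        ∫ x, (∫ t in (0 : ℝ)..1, fderiv ℝ φ (t, Φ t x) (1, 0)) ∂μ := by
      rw [← intervalIntegral_integral_swap (f := fun t x ↦ fderiv ℝ φ (t, Φ t x) (1, 0)) (key _ hg₁)]
      refine intervalIntegral.integral_congr fun t ht ↦ ?_
      rw [uIcc_of_le zero_le_one] at ht
      simp only [hρ t ht]
      exact integral_map (hΦt t).aemeasurable
        (((hφc.comp (by fun_prop : Continuous fun x : Euc d ↦ (t, x))).clm_apply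
          continuous_const).aestronglyMeasurable)
    have e₂ : (∫ t in (0 : ℝ)..1, ∫ x, fderiv ℝ φ (t, x) (0, w t x) ∂(ρ t)) =
        ∫ x, (∫ t in (0 : ℝ)..1, fderiv ℝ φ (t, Φ t x) (0, w t (Φ t x))) ∂μ := by
      rw [← intervalIntegral_integral_swap
        (f := fun t x ↦ fderiv ℝ φ (t, Φ t x) (0, w t (Φ t x))) (key _ hg₂)]
      refine intervalIntegral.integral_congr fun t ht ↦ ?_
      rw [uIcc_of_le zero_le_one] at ht
      simp only [hρ t ht]
      have hwt' := hwt t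
      exact integral_map (hΦt t).aemeasurable
        (((hφc.comp (by fun_prop : Continuous fun x : Euc d ↦ (t, x))).clm_apply
          (by fun_prop)).aestronglyMeasurable)
    have hintegral : ∀ t, Integrable (fun x ↦ φ (t, Φ t x)) μ := by
      intro t
      have hc : Continuous fun x ↦ φ (t, Φ t x) := by
        have := hΦt t; exact hφ.continuous.comp (by fun_prop)
      obtain ⟨b, hb⟩ := hΩ.exists_bound_of_continuousOn hc.continuousOn
      refine Integrable.of_bound hc.aestronglyMeasurable b ?_
      rw [← hμΩ]
      exact ae_restrict_of_forall_mem hΩ.measurableSet hb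
    rw [e₁, e₂, ← integral_add (key' _ hg₁) (key' _ hg₂)]
    have hend : ∀ t, ∫ x, φ (t, x) ∂(μ.map (Φ t)) = ∫ x, φ (t, Φ t x) ∂μ := fun t ↦
      integral_map (f := fun x ↦ φ (t, x)) (hΦt t).aemeasurable
        (hφ.continuous.comp (by fun_prop)).aestronglyMeasurable
    rw [hρ 1 ⟨zero_le_one, le_rfl⟩, hρ 0 ⟨le_rfl, zero_le_one⟩, hend, hend,
      ← integral_sub (hintegral 1) (hintegral 0)]
    refine integral_congr_ae (ae_of_all _ fun x ↦ ?_)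
    have hc₁ : Continuous fun t : ℝ ↦ fderiv ℝ φ (t, Φ t x) (1, 0) :=
      hg₁.comp (by fun_prop : Continuous fun t : ℝ ↦ (t, x))
    have hc₂ : Continuous fun t : ℝ ↦ fderiv ℝ φ (t, Φ t x) (0, w t (Φ t x)) :=
      hg₂.comp (by fun_prop : Continuous fun t : ℝ ↦ (t, x))
    simp only
    rw [← intervalIntegral.integral_add (hc₁.intervalIntegrable _ _) (hc₂.intervalIntegrable _ _)]
    -- After pulling back to `μ`, the two terms of the equation are the derivative of `φ` along one
    -- trajectory, so the identity holds for each `x` by the fundamental theorem of calculus.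
    have hder : ∀ t ∈ Ioo (0 : ℝ) 1, HasDerivAt (fun s ↦ φ (s, Φ s x))
        (fderiv ℝ φ (t, Φ t x) (1, 0) + fderiv ℝ φ (t, Φ t x) (0, w t (Φ t x))) t := by
      intro t ht
      have h1 := (hΦ x t ⟨ht.1.le, ht.2.le⟩).hasDerivAt (Icc_mem_nhds ht.1 ht.2)
      have h2 := (hφd (t, Φ t x)).hasFDerivAt.comp_hasDerivAt t ((hasDerivAt_id t).prodMk h1)
      have h3 : fderiv ℝ φ (t, Φ t x) (1, 0) + fderiv ℝ φ (t, Φ t x) (0, w t (Φ t x)) =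
          fderiv ℝ φ (t, Φ t x) (1, w t (Φ t x)) := by
        rw [← map_add, Prod.mk_add_mk, add_zero, zero_add]
      rw [h3]
      exact h2
    refine intervalIntegral.integral_eq_sub_of_hasDerivAt_of_le zero_le_one ?_ hder
      ((hc₁.add hc₂).intervalIntegrable _ _)
    exact (hφ.continuous.comp (continuous_id.prodMk
      (hΦc.comp (by fun_prop : Continuous fun t : ℝ ↦ (t, x))))).continuousOn

end Flow

/-! ### Kantorovich duality on compact spaces -/

section Duality

open CompactlySupported
variable {X Y : Type*} [MetricSpace X] [MeasurableSpace X] [MetricSpace Y] [MeasurableSpace Y]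

/-- The values of the dual problem for the upper bounds `φ ⊕ ψ + s c` of `f`. -/
def dualValues (μ : Measure X) (ν : Measure Y) (c : C(X × Y, ℝ)) (T : ℝ) (f : C(X × Y, ℝ)) :
    Set ℝ :=
  {r | ∃ (φ : C(X, ℝ)) (ψ : C(Y, ℝ)) (s : ℝ), 0 ≤ s ∧
    (∀ x y, f (x, y) ≤ φ x + ψ y + s * c (x, y)) ∧ r = ∫ x, φ x ∂μ + ∫ y, ψ y ∂ν + s * T}

variable {μ : Measure X} {ν : Measure Y} {c : C(X × Y, ℝ)} {T : ℝ}

theorem smul_mem_dualValues {a : ℝ} (ha : 0 < a) {f : C(X × Y, ℝ)} {r : ℝ}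
    (hr : r ∈ dualValues μ ν c T f) : a * r ∈ dualValues μ ν c T (a • f) := by
  obtain ⟨φ, ψ, s, hs, hle, rfl⟩ := hr
  refine ⟨a • φ, a • ψ, a * s, by positivity, fun x y ↦ ?_, ?_⟩
  · have := mul_le_mul_of_nonneg_left (hle x y) ha.le
    simp only [ContinuousMap.smul_apply, smul_eq_mul]
    linarith
  · simp only [ContinuousMap.smul_apply, smul_eq_mul, integral_const_mul]
    ring

variable [CompactSpace X] [CompactSpace Y]

theorem norm_mem_dualValues (μ : Measure X) [IsProbabilityMeasure μ] (f : C(X × Y, ℝ)) :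
    ‖f‖ ∈ dualValues μ ν c T f :=
  ⟨ContinuousMap.const X ‖f‖, 0, 0, le_rfl,
    fun x y ↦ by simpa using (le_abs_self _).trans (f.norm_coe_le_norm (x, y)), by simp⟩

variable [BorelSpace X] [BorelSpace Y]

theorem integrable_continuousMap {μ : Measure X} [IsFiniteMeasure μ] (φ : C(X, ℝ)) :
    Integrable φ μ := by
  rw [← integrableOn_univ]
  exact φ.continuous.continuousOn.integrableOn_compact isCompact_univ

variable [IsProbabilityMeasure μ] [IsProbabilityMeasure ν]

theorem add_mem_dualValues {f g : C(X × Y, ℝ)} {r q : ℝ} (hr : r ∈ dualValues μ ν c T f)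
    (hq : q ∈ dualValues μ ν c T g) : r + q ∈ dualValues μ ν c T (f + g) := by
  obtain ⟨φ, ψ, s, hs, hle, rfl⟩ := hr
  obtain ⟨φ', ψ', s', hs', hle', rfl⟩ := hq
  refine ⟨φ + φ', ψ + ψ', s + s', by positivity, fun x y ↦ ?_, ?_⟩
  · have h1 := hle x y
    have h2 := hle' x y
    simp only [ContinuousMap.add_apply]
    linarith
  · simp only [ContinuousMap.add_apply]
    rw [integral_add (integrable_continuousMap φ) (integrable_continuousMap φ'),
      integral_add (integrable_continuousMap ψ) (integrable_continuousMap ψ')]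
    ring

/-- The bound on the dual problem enters here, to keep the infimum of the dual values finite. If `s
> 0`, multiplying `-‖f‖ ≤ φ + ψ + s c` by `-1/s` yields an admissible pair. If `s = 0`, it suffices
to integrate the inequality in both variables. -/
theorem neg_norm_le_of_mem_dualValues
    (hdual : ∀ (φ : C(X, ℝ)) (ψ : C(Y, ℝ)), (∀ x y, φ x + ψ y ≤ c (x, y)) →
      ∫ x, φ x ∂μ + ∫ y, ψ y ∂ν ≤ T) {f : C(X × Y, ℝ)} {r : ℝ}
    (hr : r ∈ dualValues μ ν c T f) : -‖f‖ ≤ r := by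
  obtain ⟨φ, ψ, s, hs, hle, rfl⟩ := hr
  have hf : ∀ x y, -‖f‖ ≤ φ x + ψ y + s * c (x, y) := fun x y ↦
    (neg_le_of_abs_le (f.norm_coe_le_norm (x, y))).trans (hle x y)
  rcases hs.eq_or_lt with rfl | hs0
  · have h1 : ∀ y, -‖f‖ - ψ y ≤ ∫ x, φ x ∂μ := by
      intro y
      calc -‖f‖ - ψ y = ∫ _x, (-‖f‖ - ψ y) ∂μ := by simp
        _ ≤ _ := integral_mono (integrable_const _) (integrable_continuousMap φ)
          (fun x ↦ by have := hf x y; simp only [zero_mul] at this; linarith)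
    have h2 : -‖f‖ - ∫ x, φ x ∂μ ≤ ∫ y, ψ y ∂ν := by
      calc -‖f‖ - ∫ x, φ x ∂μ = ∫ _y, (-‖f‖ - ∫ x, φ x ∂μ) ∂ν := by simp
        _ ≤ _ := integral_mono (integrable_const _) (integrable_continuousMap ψ)
          (fun y ↦ by have := h1 y; linarith)
    linarith
  · have h1 := hdual ((-s⁻¹) • (φ + ContinuousMap.const X ‖f‖)) ((-s⁻¹) • ψ) (fun x y ↦ by
      have h2 := mul_le_mul_of_nonneg_left (hf x y) (inv_pos.2 hs0).le
      have h3 : s⁻¹ * (s * c (x, y)) = c (x, y) := by field_simp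
      simp only [ContinuousMap.smul_apply, ContinuousMap.add_apply, ContinuousMap.const_apply,
        smul_eq_mul]
      rw [mul_add, h3] at h2
      linarith)
    simp only [ContinuousMap.smul_apply, ContinuousMap.add_apply, ContinuousMap.const_apply,
      smul_eq_mul, integral_const_mul] at h1
    rw [integral_add (integrable_continuousMap φ) (integrable_const _)] at h1
    simp only [integral_const, probReal_univ, smul_eq_mul, one_mul] at h1
    have h4 := mul_le_mul_of_nonneg_left h1 hs0.le
    have h5 : s * (-s⁻¹ * (∫ x, φ x ∂μ + ‖f‖) + -s⁻¹ * ∫ y, ψ y ∂ν) =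
        -(∫ x, φ x ∂μ + ‖f‖ + ∫ y, ψ y ∂ν) := by field_simp; ring
    rw [h5] at h4
    linarith

/-- Kantorovich duality on compact spaces: if `T` bounds the dual problem from above, then there is
a coupling with cost at most `T`. -/
theorem exists_coupling_integral_le
    (hdual : ∀ (φ : C(X, ℝ)) (ψ : C(Y, ℝ)), (∀ x y, φ x + ψ y ≤ c (x, y)) →
      ∫ x, φ x ∂μ + ∫ y, ψ y ∂ν ≤ T) :
    ∃ p : Measure (X × Y), IsFiniteMeasure p ∧ p.fst = μ ∧ p.snd = ν ∧ ∫ z, c z ∂p ≤ T := by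
  -- This infimum is sublinear, so Hahn–Banach, started from the zero subspace, gives a linear `g ≤
  -- N`. The choice of dual values forces `g` to be positive, to have marginals `μ` and `ν`, and to
  -- satisfy `g c ≤ T`; Riesz turns it into the coupling.
  let N : C(X × Y, ℝ) → ℝ := fun f ↦ sInf (dualValues μ ν c T f)
  have hbdd : ∀ f, BddBelow (dualValues μ ν c T f) := fun f ↦
    ⟨-‖f‖, fun r hr ↦ neg_norm_le_of_mem_dualValues hdual hr⟩
  have hne : ∀ f, (dualValues μ ν c T f).Nonempty := fun f ↦ ⟨_, norm_mem_dualValues μ f⟩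
  have hhom_le : ∀ a : ℝ, 0 < a → ∀ f, N (a • f) ≤ a * N f := by
    intro a ha f
    rw [← div_le_iff₀' ha]
    refine le_csInf (hne f) fun r hr ↦ ?_
    rw [div_le_iff₀' ha]
    exact csInf_le (hbdd _) (smul_mem_dualValues ha hr)
  have hhom : ∀ a : ℝ, 0 < a → ∀ f, N (a • f) = a * N f := by
    intro a ha f
    refine le_antisymm (hhom_le a ha f) ?_
    have := hhom_le a⁻¹ (inv_pos.2 ha) (a • f)
    rw [smul_smul, inv_mul_cancel₀ ha.ne', one_smul, inv_mul_eq_div, le_div_iff₀' ha] at this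
    exact this
  have hadd : ∀ f g, N (f + g) ≤ N f + N g := by
    intro f g
    rw [← sub_le_iff_le_add]
    refine le_csInf (hne f) fun r hr ↦ ?_
    rw [sub_le_comm]
    refine le_csInf (hne g) fun q hq ↦ ?_
    rw [sub_le_iff_le_add']
    exact csInf_le (hbdd _) (add_mem_dualValues hr hq)
  obtain ⟨g, -, hg⟩ := exists_extension_of_le_sublinear (⊥ : C(X × Y, ℝ) →ₗ.[ℝ] ℝ) N hhom hadd
    (by
      rintro ⟨x, hx⟩
      have hx0 : x = 0 := (Submodule.mem_bot ℝ).1 hx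
      subst hx0
      have h2 : N 0 = 0 := by
        have := hhom 2 two_pos 0
        rw [smul_zero] at this
        linarith
      rw [h2]
      exact le_of_eq (LinearPMap.map_zero _))
  have hgle : ∀ {f : C(X × Y, ℝ)} {r : ℝ}, r ∈ dualValues μ ν c T f → g f ≤ r := fun hr ↦
    (hg _).trans (csInf_le (hbdd _) hr)
  have hpos : ∀ f : C(X × Y, ℝ), 0 ≤ f → 0 ≤ g f := by
    intro f hf
    have := hgle (f := -f) (r := 0) ⟨0, 0, 0, le_rfl, fun x y ↦ by simpa using hf (x, y), by simp⟩
    rw [map_neg] at this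
    linarith
  let G : C_c(X × Y, ℝ) →ₗ[ℝ] ℝ :=
    { toFun := fun f ↦ g f.toContinuousMap
      map_add' := fun f f' ↦ g.map_add _ _
      map_smul' := fun a f ↦ g.map_smul _ _ }
  let Λ : C_c(X × Y, ℝ) →ₚ[ℝ] ℝ := PositiveLinearMap.mk₀ G fun f hf ↦ hpos _ hf
  let p := RealRMK.rieszMeasure Λ
  have hp : ∀ f : C(X × Y, ℝ), ∫ z, f z ∂p = g f := fun f ↦
    RealRMK.integral_rieszMeasure Λ
      ⟨f, HasCompactSupport.of_compactSpace f⟩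
  have hfin : IsFiniteMeasure p := inferInstance
  refine ⟨p, hfin, ?_, ?_, ?_⟩
  · refine ext_of_forall_integral_eq_of_IsFiniteMeasure fun φ ↦ ?_
    rw [Measure.fst, integral_map measurable_fst.aemeasurable
      φ.continuous.aestronglyMeasurable]
    have h1 := hp (φ.toContinuousMap.comp ContinuousMap.fst)
    -- For a function of one variable, both it and its negative have their integral as a dual value,
    -- so the two inequalities give the marginal exactly.
    have h2 := hgle (f := φ.toContinuousMap.comp ContinuousMap.fst)
      ⟨φ.toContinuousMap, 0, 0, le_rfl, fun x y ↦ by simp, rfl⟩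
    have h3 := hgle (f := -φ.toContinuousMap.comp ContinuousMap.fst)
      ⟨-φ.toContinuousMap, 0, 0, le_rfl, fun x y ↦ by simp, rfl⟩
    simp [integral_neg] at h1 h2 h3
    linarith
  · refine ext_of_forall_integral_eq_of_IsFiniteMeasure fun φ ↦ ?_
    rw [Measure.snd, integral_map measurable_snd.aemeasurable
      φ.continuous.aestronglyMeasurable]
    have h1 := hp (φ.toContinuousMap.comp ContinuousMap.snd)
    have h2 := hgle (f := φ.toContinuousMap.comp ContinuousMap.snd)
      ⟨0, φ.toContinuousMap, 0, le_rfl, fun x y ↦ by simp, rfl⟩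
    have h3 := hgle (f := -φ.toContinuousMap.comp ContinuousMap.snd)
      ⟨0, -φ.toContinuousMap, 0, le_rfl, fun x y ↦ by simp, rfl⟩
    simp [integral_neg] at h1 h2 h3
    linarith
  · rw [hp]
    exact hgle ⟨0, 0, 1, zero_le_one, fun x y ↦ by simp, by simp⟩

end Duality

/-! ### Wasserstein distance: duality and Lipschitz curves of measures -/

section Wasserstein

variable {d : ℕ} {μ ν : Measure (Euc d)}

theorem rpow_half_sq (x : ℝ≥0∞) : (x ^ (1 / 2 : ℝ)) ^ 2 = x := by
  rw [← ENNReal.rpow_natCast, ← ENNReal.rpow_mul]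
  norm_num

theorem W_sq (μ ν : Measure (Euc d)) : W μ ν ^ 2 =
    ⨅ (p : Measure (Euc d × Euc d)) (_ : p.fst = μ ∧ p.snd = ν), ∫⁻ z, ‖z.1 - z.2‖ₑ ^ 2 ∂p := by
  rw [W, rpow_half_sq]

theorem le_W {a : ℝ≥0∞} (h : ∀ p : Measure (Euc d × Euc d), p.fst = μ → p.snd = ν →
    a ^ 2 ≤ ∫⁻ z, ‖z.1 - z.2‖ₑ ^ 2 ∂p) : a ≤ W μ ν := by
  rw [← ENNReal.pow_le_pow_left_iff two_ne_zero, W_sq]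
  exact le_iInf₂ fun p hp ↦ h p hp.1 hp.2

/-- Kantorovich duality for measures that are concentrated on a compact subset of `ℝ^d`. -/
theorem W_sq_le_of_dual {Ω : Set (Euc d)} (hΩ : IsCompact Ω) [IsProbabilityMeasure μ]
    [IsProbabilityMeasure ν] (hμ : μ Ωᶜ = 0) (hν : ν Ωᶜ = 0) {T : ℝ}
    (hdual : ∀ (φ ψ : C(Ω, ℝ)), (∀ x y : Ω, φ x + ψ y ≤ ‖(x : Euc d) - y‖ ^ 2) →
      ∫ x, φ x ∂(μ.comap Subtype.val) + ∫ y, ψ y ∂(ν.comap Subtype.val) ≤ T) :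
    W μ ν ^ 2 ≤ ENNReal.ofReal T := by
  have hΩm := hΩ.measurableSet
  have : CompactSpace Ω := isCompact_iff_compactSpace.1 hΩ
  have hres : ∀ {μ : Measure (Euc d)}, μ Ωᶜ = 0 →
      (μ.comap (Subtype.val : Ω → Euc d)).map Subtype.val = μ := fun h ↦ by
    rw [map_comap_subtype_coe hΩm, Measure.restrict_eq_self_of_ae_mem h]
  have hprob : ∀ {μ : Measure (Euc d)} [IsProbabilityMeasure μ], μ Ωᶜ = 0 →
      IsProbabilityMeasure (μ.comap (Subtype.val : Ω → Euc d)) := fun {μ} _ h ↦ by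
    constructor
    rw [comap_subtype_coe_apply hΩm, image_univ, Subtype.range_coe]
    exact (prob_compl_eq_zero_iff hΩm).1 h
  have := hprob hμ
  have := hprob hν
  let c : C(Ω × Ω, ℝ) := ⟨fun z ↦ ‖(z.1 : Euc d) - z.2‖ ^ 2, by fun_prop⟩
  obtain ⟨p, hpf, hp1, hp2, hpT⟩ := exists_coupling_integral_le (c := c) (T := T) hdual
  rw [W_sq]
  have hmap : Measurable fun z : Ω × Ω ↦ ((z.1 : Euc d), (z.2 : Euc d)) := by fun_prop
  refine iInf₂_le_of_le (p.map fun z ↦ ((z.1 : Euc d), (z.2 : Euc d))) ⟨?_, ?_⟩ ?_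
  · rw [Measure.fst, Measure.map_map measurable_fst hmap, ← hres hμ, ← hp1, Measure.fst,
      Measure.map_map measurable_subtype_coe measurable_fst]
    rfl
  · rw [Measure.snd, Measure.map_map measurable_snd hmap, ← hres hν, ← hp2, Measure.snd,
      Measure.map_map measurable_subtype_coe measurable_snd]
    rfl
  · rw [lintegral_map (by fun_prop) hmap]
    refine le_trans (le_of_eq ?_) (ENNReal.ofReal_le_ofReal hpT)
    rw [ofReal_integral_eq_lintegral_ofReal (integrable_continuousMap c)
      (ae_of_all _ fun z ↦ by simp only [c, ContinuousMap.coe_mk, Pi.zero_apply]; positivity)]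
    refine lintegral_congr fun z ↦ ?_
    simp only [c, ContinuousMap.coe_mk]
    rw [ENNReal.ofReal_pow (norm_nonneg _), ofReal_norm]

/-- Integrals of Lipschitz functions are Lipschitz with respect to the Wasserstein distance. -/
theorem lintegral_le_add_mul_W [IsProbabilityMeasure μ] {f : Euc d → ℝ≥0} {L : ℝ≥0}
    (hL : 0 < L) (hf : LipschitzWith L f) :
    ∫⁻ x, f x ∂μ ≤ ∫⁻ x, f x ∂ν + L * W μ ν := by
  have hfm : Measurable fun x ↦ (f x : ℝ≥0∞) :=
    (ENNReal.continuous_coe.comp hf.continuous).measurable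
  have hfm₂ : Measurable fun z : Euc d × Euc d ↦ (f z.2 : ℝ≥0∞) := hfm.comp measurable_snd
  have hL' : (L : ℝ≥0∞) ≠ 0 := by exact_mod_cast hL.ne'
  suffices (∫⁻ x, f x ∂μ - ∫⁻ x, f x ∂ν) / L ≤ W μ ν by
    rw [ENNReal.div_le_iff' hL' ENNReal.coe_ne_top] at this
    exact tsub_le_iff_left.1 this
  refine le_W fun p hp1 hp2 ↦ ?_
  have hpp : IsProbabilityMeasure p := by
    constructor
    have : μ univ = 1 := measure_univ
    rw [← hp1, Measure.fst_univ] at this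
    exact this
  have h1 : ∫⁻ x, f x ∂μ ≤ ∫⁻ x, f x ∂ν + L * ∫⁻ z, ‖z.1 - z.2‖ₑ ∂p := by
    rw [← hp1, ← hp2, Measure.fst, Measure.snd, lintegral_map hfm measurable_fst,
      lintegral_map hfm measurable_snd, ← lintegral_const_mul _ (by fun_prop),
      ← lintegral_add_left hfm₂]
    refine lintegral_mono fun z ↦ ?_
    have h2 : (f z.1 : ℝ≥0∞) ≤ f z.2 + edist (f z.1) (f z.2) := by
      rw [edist_nndist]
      exact_mod_cast NNReal.le_add_nndist _ _
    refine h2.trans ?_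
    gcongr
    rw [← edist_eq_enorm_sub]
    exact hf z.1 z.2
  have h3 : (∫⁻ z, ‖z.1 - z.2‖ₑ ∂p) ^ 2 ≤ ∫⁻ z, ‖z.1 - z.2‖ₑ ^ 2 ∂p := by
    have := ENNReal.lintegral_mul_le_Lp_mul_Lq p Real.HolderConjugate.two_two
      (f := fun z ↦ ‖z.1 - z.2‖ₑ) (g := 1) (by fun_prop) (by fun_prop)
    simp only [Pi.mul_apply, Pi.one_apply, mul_one, ENNReal.rpow_ofNat, one_pow, lintegral_one,
      measure_univ, ENNReal.one_rpow] at this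
    calc _ ≤ ((∫⁻ z, ‖z.1 - z.2‖ₑ ^ 2 ∂p) ^ (1 / 2 : ℝ)) ^ 2 := by gcongr
      _ = _ := rpow_half_sq _
  refine le_trans ?_ h3
  gcongr
  rw [ENNReal.div_le_iff' hL' ENNReal.coe_ne_top]
  exact tsub_le_iff_left.2 h1

/-- A curve of probability measures that is Lipschitz for the Wasserstein distance is measurable. -/
theorem measurable_of_W_le {ρ : ℝ → Measure (Euc d)} [∀ t, IsProbabilityMeasure (ρ t)] {K : ℝ≥0}
    (hρ : ∀ s t, W (ρ s) (ρ t) ≤ K * edist s t) : Measurable ρ := by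
  refine Measurable.measure_of_isPiSystem_of_isProbabilityMeasure
    (BorelSpace.measurable_eq.trans borel_eq_generateFrom_isClosed) isPiSystem_isClosed ?_
  intro F hF
  have hpos : ∀ n : ℕ, (0 : ℝ) < 1 / ((n : ℝ) + 1) := fun n ↦ by positivity
  -- The mass of a closed set is the limit of integrals of Lipschitz cutoffs, and each of these
  -- integrals is continuous in time by the bound on `W`.
  refine measurable_of_tendsto_metrizable (f := fun (n : ℕ) t ↦
    ∫⁻ x, thickenedIndicator (hpos n) F x ∂(ρ t)) (fun n ↦ ?_) ?_
  · obtain ⟨L, hL0, hL⟩ : ∃ L : ℝ≥0, 0 < L ∧ LipschitzWith L (thickenedIndicator (hpos n) F) :=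
      ⟨_, add_pos_of_nonneg_of_pos zero_le one_pos,
        (lipschitzWith_thickenedIndicator (hpos n) F).weaken le_self_add⟩
    refine (continuous_of_le_add_edist (L * K : ℝ≥0∞) (by finiteness) fun s t ↦ ?_).measurable
    refine (lintegral_le_add_mul_W (ν := ρ t) hL0 hL).trans ?_
    rw [mul_assoc]
    gcongr
    exact hρ s t
  · rw [tendsto_pi_nhds]
    intro t
    exact tendsto_lintegral_thickenedIndicator_of_isClosed (ρ t) hF hpos
      tendsto_one_div_add_atTop_nhds_zero_nat

end Wasserstein

/-! ### Smooth substitutes for the minimum and for the time shift -/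

section SoftMin

/-- A smooth approximation of the minimum of `a` over `s`. -/
def softMin {ι : Type*} (ε : ℝ) (s : Finset ι) (a : ι → ℝ) : ℝ :=
  -ε * Real.log (∑ i ∈ s, Real.exp (-a i / ε))

variable {ι : Type*} {ε : ℝ} {s : Finset ι} {a b : ι → ℝ}

theorem sum_exp_pos (hs : s.Nonempty) : 0 < ∑ i ∈ s, Real.exp (-a i / ε) :=
  Finset.sum_pos (fun _ _ ↦ Real.exp_pos _) hs

/-- The exponential sum of `b` is at least `exp (-k / ε)` times that of `a`. Like the minimum,
`softMin` is thus monotone and compatible with adding constants, which lets estimates for each `y`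
pass to the Hopf–Lax function. -/
theorem softMin_le_add (hε : 0 < ε) (hs : s.Nonempty) {k : ℝ} (h : ∀ i ∈ s, b i ≤ a i + k) :
    softMin ε s b ≤ softMin ε s a + k := by
  have h1 : Real.exp (-k / ε) * ∑ i ∈ s, Real.exp (-a i / ε) ≤ ∑ i ∈ s, Real.exp (-b i / ε) := by
    rw [Finset.mul_sum]
    refine Finset.sum_le_sum fun i hi ↦ ?_
    rw [← Real.exp_add, ← add_div]
    gcongr
    linarith [h i hi]
  have h2 := Real.log_le_log (mul_pos (Real.exp_pos _) (sum_exp_pos hs)) h1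
  rw [Real.log_mul (Real.exp_pos _).ne' (sum_exp_pos hs).ne', Real.log_exp] at h2
  have h3 := mul_le_mul_of_nonneg_left h2 hε.le
  rw [mul_add, mul_div_cancel₀ _ hε.ne'] at h3
  unfold softMin
  linarith

theorem softMin_le (hε : 0 < ε) {i : ι} (hi : i ∈ s) : softMin ε s a ≤ a i := by
  have h1 : Real.exp (-a i / ε) ≤ ∑ i ∈ s, Real.exp (-a i / ε) :=
    Finset.single_le_sum (f := fun i ↦ Real.exp (-a i / ε)) (fun _ _ ↦ (Real.exp_pos _).le) hi
  have h2 := Real.log_le_log (Real.exp_pos _) h1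
  rw [Real.log_exp] at h2
  have h3 := mul_le_mul_of_nonneg_left h2 hε.le
  rw [mul_div_cancel₀ _ hε.ne'] at h3
  unfold softMin
  linarith

/-- Comparison with the zero family, whose soft minimum is exactly `-ε log (card s)`. -/
theorem le_softMin (hε : 0 < ε) (hs : s.Nonempty) {k : ℝ} (h : ∀ i ∈ s, k ≤ a i) :
    k - ε * Real.log s.card ≤ softMin ε s a := by
  have h1 := softMin_le_add (a := a) (b := fun _ ↦ 0) (k := -k) hε hs
    (fun i hi ↦ by linarith [h i hi])
  have h2 : softMin ε s (fun _ ↦ 0) = -ε * Real.log s.card := by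
    simp [softMin]
  rw [h2] at h1
  linarith

/-- A positive smooth function that equals `t + δ` near `[0, ∞)`. -/
theorem exists_smooth_shift {δ : ℝ} (hδ : 0 < δ) : ∃ τ : ℝ → ℝ, ContDiff ℝ 1 τ ∧ (∀ t, 0 < τ t) ∧
    ∀ t, 0 ≤ t → τ t = t + δ := by
  -- Test functions must be `C¹` at all times, including negative ones where `t + δ` vanishes. The
  -- transition is complete at `t = 0`; for `t ≤ -3δ/4` it is off and leaves `δ / 4`.
  refine ⟨fun t ↦ δ / 4 + (t + 3 * δ / 4) * Real.smoothTransition ((t + 3 * δ / 4) * (4 / (3 * δ))),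
    ?_, fun t ↦ ?_, fun t ht ↦ ?_⟩
  · have : ContDiff ℝ 1 Real.smoothTransition := Real.smoothTransition.contDiff
    fun_prop
  · have h0 : 0 ≤ (t + 3 * δ / 4) * Real.smoothTransition ((t + 3 * δ / 4) * (4 / (3 * δ))) := by
      rcases le_total 0 (t + 3 * δ / 4) with h | h
      · exact mul_nonneg h (Real.smoothTransition.nonneg _)
      · rw [Real.smoothTransition.zero_of_nonpos (mul_nonpos_of_nonpos_of_nonneg h (by positivity)),
          mul_zero]
    linarith [h0]
  · have h1 : 1 ≤ (t + 3 * δ / 4) * (4 / (3 * δ)) := by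
      have : (t + 3 * δ / 4) * (4 / (3 * δ)) = t * (4 / (3 * δ)) + 1 := by field_simp
      rw [this]
      have : 0 ≤ t * (4 / (3 * δ)) := by positivity
      linarith
    simp only [Real.smoothTransition.one_of_one_le h1]
    ring

end SoftMin

/-! ### Hopf–Lax subsolutions of the Hamilton–Jacobi equation -/

section TestFunction

variable {d : ℕ}

/-- Subadditivity of the convex, homogeneous function `(q, τ) ↦ |q|² / τ`, with `|h p|² / h = h
|p|²`. The gap is a multiple of `‖q - τ p‖²`. -/
theorem norm_sq_div_add_le (q p : Euc d) {τ h : ℝ} (hτ : 0 < τ) (hh : 0 < h) :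
    ‖q + h • p‖ ^ 2 / (τ + h) ≤ ‖q‖ ^ 2 / τ + h * ‖p‖ ^ 2 := by
  rw [div_le_iff₀ (by positivity), norm_add_sq_real, norm_smul, Real.norm_of_nonneg hh.le,
    inner_smul_right]
  have h1 : 0 ≤ ‖q - τ • p‖ ^ 2 := by positivity
  rw [norm_sub_sq_real, norm_smul, Real.norm_of_nonneg hτ.le, inner_smul_right] at h1
  have h2 : 2 * inner ℝ q p ≤ ‖q‖ ^ 2 / τ + τ * ‖p‖ ^ 2 := by
    rw [← sub_nonneg]
    have : ‖q‖ ^ 2 / τ + τ * ‖p‖ ^ 2 - 2 * inner ℝ q p =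
        (‖q‖ ^ 2 - 2 * (τ * inner ℝ q p) + (τ * ‖p‖) ^ 2) / τ := by field_simp; ring
    rw [this]; positivity
  have h3 : (‖q‖ ^ 2 / τ + h * ‖p‖ ^ 2) * (τ + h) =
      ‖q‖ ^ 2 + h * (‖q‖ ^ 2 / τ + τ * ‖p‖ ^ 2) + h ^ 2 * ‖p‖ ^ 2 := by field_simp; ring
  rw [h3]
  nlinarith [mul_le_mul_of_nonneg_left h2 hh.le]

/-- A regularized Hopf–Lax function with initial values `f` on the finite set `s`. -/
def hopfLax (ε : ℝ) (s : Finset (Euc d)) (f : Euc d → ℝ) (τ : ℝ → ℝ) (z : ℝ × Euc d) : ℝ :=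
  softMin ε s fun y ↦ f y + ‖z.2 - y‖ ^ 2 / τ z.1

theorem contDiff_hopfLax {ε : ℝ} {s : Finset (Euc d)} (hs : s.Nonempty) {f : Euc d → ℝ}
    {τ : ℝ → ℝ} (hτ : ContDiff ℝ 1 τ) (hτ0 : ∀ t, 0 < τ t) :
    ContDiff ℝ 1 (hopfLax ε s f τ) := by
  unfold hopfLax softMin
  refine contDiff_const.mul (ContDiff.log (ContDiff.sum fun y _ ↦ ?_) fun z ↦ (sum_exp_pos hs).ne')
  refine ContDiff.exp (ContDiff.div_const (ContDiff.neg (contDiff_const.add ?_)) _)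
  exact ContDiff.div ((contDiff_snd.sub contDiff_const).norm_sq ℝ) (hτ.comp contDiff_fst)
    fun z ↦ (hτ0 _).ne'

/-- Ranging over all `p`, this is `∂ₜφ + |∇φ|² / 4 ≤ 0`. Moving from `(t, x)` to `(t + h, x + h p)`
with `h > 0` raises each term of the soft minimum by at most `h |p|²`, hence also the soft minimum;
the bound on forward difference quotients passes to the derivative. -/
theorem fderiv_hopfLax_le {ε δ : ℝ} (hε : 0 < ε) (hδ : 0 < δ) {s : Finset (Euc d)}
    (hs : s.Nonempty) {f : Euc d → ℝ} {τ : ℝ → ℝ} (hτ : ContDiff ℝ 1 τ) (hτ0 : ∀ t, 0 < τ t)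
    (hτδ : ∀ t, 0 ≤ t → τ t = t + δ) {t : ℝ} (ht : 0 ≤ t) (x p : Euc d) :
    fderiv ℝ (hopfLax ε s f τ) (t, x) (1, p) ≤ ‖p‖ ^ 2 := by
  have hd := ((contDiff_hopfLax (ε := ε) (f := f) hs hτ hτ0).differentiable one_ne_zero
    (t, x)).hasFDerivAt
  have hline : HasDerivAt (fun h : ℝ ↦ ((t, x) : ℝ × Euc d) + h • ((1, p) : ℝ × Euc d)) (1, p) 0 := by
    simpa using ((hasDerivAt_id (0 : ℝ)).smul_const ((1, p) : ℝ × Euc d)).const_add (t, x)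
  have hd' : HasFDerivAt (hopfLax ε s f τ) (fderiv ℝ (hopfLax ε s f τ) (t, x))
      (((t, x) : ℝ × Euc d) + (0 : ℝ) • ((1, p) : ℝ × Euc d)) := by simpa using hd
  have hcomp := hd'.comp_hasDerivAt (0 : ℝ) hline
  have hslope := (hasDerivWithinAt_iff_tendsto_slope' (s := Ioi (0 : ℝ)) self_notMem_Ioi).1
    hcomp.hasDerivWithinAt
  refine le_of_tendsto hslope ?_
  filter_upwards [self_mem_nhdsWithin] with h hh
  have hh' : 0 < h := hh
  rw [slope_def_field, sub_zero, div_le_iff₀ hh']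
  simp only [Function.comp_apply, zero_smul, add_zero]
  rw [sub_le_iff_le_add', mul_comm]
  refine softMin_le_add hε hs fun y _ ↦ ?_
  have h1 := norm_sq_div_add_le (x - y) p (τ := t + δ) (by positivity) hh'
  simp only [Prod.smul_mk, Prod.mk_add_mk, smul_eq_mul, mul_one, hτδ t ht,
    hτδ (t + h) (by positivity)]
  have e1 : x + h • p - y = x - y + h • p := by abel
  have e2 : t + h + δ = t + δ + h := by ring
  rw [e1, e2]
  linarith

end TestFunction

/-! ### The kinetic energy bounds the squared Wasserstein distance -/

section LowerBound

open ProbabilityTheory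
variable {d : ℕ} {Ω : Set (Euc d)} {ρ : ℝ → Measure (Euc d)} {v : ℝ → Euc d → Euc d}

/-- Testing the continuity equation with a subsolution of the Hamilton–Jacobi equation. -/
theorem integral_sub_le_of_subsolution (hΩ : IsCompact Ω)
    (hprob : ∀ t ∈ Icc (0 : ℝ) 1, IsProbabilityMeasure (ρ t))
    (hρΩ : ∀ t ∈ Icc (0 : ℝ) 1, ρ t Ωᶜ = 0)
    (hlip : ∃ K : ℝ≥0, ∀ s ∈ Icc (0 : ℝ) 1, ∀ t ∈ Icc (0 : ℝ) 1, W (ρ s) (ρ t) ≤ K * edist s t)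
    (hv : IsContinuityEq ρ v)
    (hfin : ∫⁻ t in Icc (0 : ℝ) 1, ∫⁻ x, ‖v t x‖ₑ ^ 2 ∂(ρ t) ≠ ⊤)
    {φ : ℝ × Euc d → ℝ} (hφ : ContDiff ℝ 1 φ)
    (hsub : ∀ t ∈ Icc (0 : ℝ) 1, ∀ x p, fderiv ℝ φ (t, x) (1, p) ≤ ‖p‖ ^ 2) :
    (∫ x, φ (1, x) ∂(ρ 1)) - ∫ x, φ (0, x) ∂(ρ 0) ≤
      (∫⁻ t in Icc (0 : ℝ) 1, ∫⁻ x, ‖v t x‖ₑ ^ 2 ∂(ρ t)).toReal := by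
  obtain ⟨K, hK⟩ := hlip
  -- Nothing is known about `ρ` outside `[0,1]`. Freezing it at the end points gives a Lipschitz,
  -- hence measurable, family: a Markov kernel, so that the iterated integrals become integrals over
  -- one measure `P`.
  let ρ' : ℝ → Measure (Euc d) := fun t ↦ ρ (projIcc 0 1 zero_le_one t)
  have hρ' : ∀ t ∈ Icc (0 : ℝ) 1, ρ' t = ρ t := fun t ht ↦ by
    simp only [ρ', projIcc_of_mem _ ht]
  have : ∀ t, IsProbabilityMeasure (ρ' t) := fun t ↦ hprob _ (projIcc 0 1 zero_le_one t).2
  have hmeas : Measurable ρ' := by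
    refine measurable_of_W_le (K := K) fun s t ↦ ?_
    refine (hK _ (projIcc 0 1 zero_le_one s).2 _ (projIcc 0 1 zero_le_one t).2).trans ?_
    gcongr
    have := (LipschitzWith.projIcc (zero_le_one (α := ℝ))) s t
    rwa [ENNReal.coe_one, one_mul, Subtype.edist_eq] at this
  let κ : Kernel ℝ (Euc d) := ⟨ρ', hmeas⟩
  have : IsMarkovKernel κ := ⟨this⟩
  have hκ : ∀ t ∈ Icc (0 : ℝ) 1, κ t = ρ t := hρ'
  let P : Measure (ℝ × Euc d) := (volume.restrict (Icc (0 : ℝ) 1)) ⊗ₘ κ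
  have hPmem : ∀ᵐ z ∂P, z ∈ Icc (0 : ℝ) 1 ×ˢ Ω := by
    refine (Measure.ae_compProd_iff (measurableSet_Icc.prod hΩ.measurableSet)).2 ?_
    refine ae_restrict_of_forall_mem measurableSet_Icc fun t ht ↦ ?_
    rw [hκ t ht]
    have : ∀ᵐ x ∂(ρ t), x ∈ Ω := hρΩ t ht
    filter_upwards [this] with x hx using ⟨ht, hx⟩
  have hvm : Measurable fun z : ℝ × Euc d ↦ v z.1 z.2 := hv.measurable
  have hPv : ∫⁻ z, ‖v z.1 z.2‖ₑ ^ 2 ∂P = ∫⁻ t in Icc (0 : ℝ) 1, ∫⁻ x, ‖v t x‖ₑ ^ 2 ∂(ρ t) := by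
    rw [Measure.lintegral_compProd (by fun_prop)]
    exact setLIntegral_congr_fun measurableSet_Icc fun t ht ↦ by simp only [hκ t ht]
  have hswap : ∀ g : ℝ × Euc d → ℝ, Integrable g P →
      ∫ t in (0 : ℝ)..1, ∫ x, g (t, x) ∂(ρ t) = ∫ z, g z ∂P := by
    intro g hg
    rw [Measure.integral_compProd hg, intervalIntegral.integral_of_le zero_le_one,
      ← integral_Icc_eq_integral_Ioc]
    exact setIntegral_congr_fun measurableSet_Icc fun t ht ↦ by simp only [hκ t ht]
  have hvL2 : MemLp (fun z : ℝ × Euc d ↦ v z.1 z.2) 2 P := by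
    refine ⟨hvm.aestronglyMeasurable, ?_⟩
    rw [eLpNorm_lt_top_iff_lintegral_rpow_enorm_lt_top (by norm_num) (by norm_num)]
    simp only [ENNReal.toReal_ofNat, ENNReal.rpow_ofNat]
    rw [hPv]
    exact hfin.lt_top
  have hDc : Continuous (fderiv ℝ φ) := hφ.continuous_fderiv one_ne_zero
  obtain ⟨b, hb⟩ := (isCompact_Icc.prod hΩ).exists_bound_of_continuousOn
    (f := fderiv ℝ φ) (s := Icc (0 : ℝ) 1 ×ˢ Ω) hDc.continuousOn
  have hg₁ : Integrable (fun z : ℝ × Euc d ↦ fderiv ℝ φ z (1, 0)) P := by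
    refine Integrable.of_bound (hDc.clm_apply continuous_const).aestronglyMeasurable
      (b * ‖((1, 0) : ℝ × Euc d)‖) ?_
    filter_upwards [hPmem] with z hz
    exact (fderiv ℝ φ z).le_of_opNorm_le (hb z hz) _
  have hg₂ : Integrable (fun z : ℝ × Euc d ↦ fderiv ℝ φ z (0, v z.1 z.2)) P := by
    refine Integrable.mono' ((hvL2.integrable one_le_two).norm.const_mul b) ?_ ?_
    · have hm : Measurable fun z : ℝ × Euc d ↦ (fderiv ℝ φ z, ((0 : ℝ), v z.1 z.2)) :=
        hDc.measurable.prodMk (measurable_const.prodMk hvm)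
      have hc : Continuous fun q : ((ℝ × Euc d) →L[ℝ] ℝ) × (ℝ × Euc d) ↦ q.1 q.2 :=
        continuous_fst.clm_apply continuous_snd
      exact (hc.measurable.comp hm).aestronglyMeasurable
    · filter_upwards [hPmem] with z hz
      refine ((fderiv ℝ φ z).le_of_opNorm_le (hb z hz) _).trans (le_of_eq ?_)
      simp [Prod.norm_mk]
  have hce := hv.continuity φ hφ
  rw [hswap _ hg₁, hswap (fun z ↦ fderiv ℝ φ z (0, v z.1 z.2)) hg₂,
    ← integral_add hg₁ hg₂] at hce
  rw [← hce, ← hPv]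
  have hsq : ∫ z, ‖v z.1 z.2‖ ^ 2 ∂P = (∫⁻ z, ‖v z.1 z.2‖ₑ ^ 2 ∂P).toReal := by
    rw [integral_eq_lintegral_of_nonneg_ae (ae_of_all _ fun z ↦ by positivity)
      (by fun_prop)]
    congr 1
    refine lintegral_congr fun z ↦ ?_
    rw [ENNReal.ofReal_pow (norm_nonneg _), ofReal_norm]
  rw [← hsq]
  refine integral_mono_ae (hg₁.add hg₂) (hvL2.integrable_norm_pow two_ne_zero) ?_
  filter_upwards [hPmem] with z hz
  have h1 := hsub z.1 hz.1 z.2 (v z.1 z.2)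
  have h2 : fderiv ℝ φ z (1, 0) + fderiv ℝ φ z (0, v z.1 z.2) = fderiv ℝ φ z (1, v z.1 z.2) := by
    rw [← map_add, Prod.mk_add_mk, add_zero, zero_add]
  rw [h2]
  exact h1

/-- The kinetic energy of a curve bounds the squared Wasserstein distance of its end points. -/
theorem W_sq_le_lintegral (hΩ : IsCompact Ω)
    (hprob : ∀ t ∈ Icc (0 : ℝ) 1, IsProbabilityMeasure (ρ t))
    (hρΩ : ∀ t ∈ Icc (0 : ℝ) 1, ρ t Ωᶜ = 0)
    (hlip : ∃ K : ℝ≥0, ∀ s ∈ Icc (0 : ℝ) 1, ∀ t ∈ Icc (0 : ℝ) 1, W (ρ s) (ρ t) ≤ K * edist s t)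
    (hv : IsContinuityEq ρ v) :
    W (ρ 0) (ρ 1) ^ 2 ≤ ∫⁻ t in Icc (0 : ℝ) 1, ∫⁻ x, ‖v t x‖ₑ ^ 2 ∂(ρ t) := by
  rcases eq_or_ne (∫⁻ t in Icc (0 : ℝ) 1, ∫⁻ x, ‖v t x‖ₑ ^ 2 ∂(ρ t)) ⊤ with hfin | hfin
  · rw [hfin]; exact le_top
  rw [← ENNReal.ofReal_toReal hfin]
  set T := (∫⁻ t in Icc (0 : ℝ) 1, ∫⁻ x, ‖v t x‖ₑ ^ 2 ∂(ρ t)).toReal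
  have h0mem : (0 : ℝ) ∈ Icc (0 : ℝ) 1 := ⟨le_rfl, zero_le_one⟩
  have h1mem : (1 : ℝ) ∈ Icc (0 : ℝ) 1 := ⟨zero_le_one, le_rfl⟩
  have := hprob 0 h0mem
  have := hprob 1 h1mem
  refine W_sq_le_of_dual hΩ (hρΩ 0 h0mem) (hρΩ 1 h1mem) fun φ ψ hφψ ↦ ?_
  have : CompactSpace Ω := isCompact_iff_compactSpace.1 hΩ
  have hΩm := hΩ.measurableSet
  have hΩne : Nonempty Ω := by
    by_contra hne
    rw [not_nonempty_iff, isEmpty_coe_sort] at hne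
    have h := hρΩ 0 h0mem
    rw [hne, compl_empty, measure_univ] at h
    exact one_ne_zero h
  obtain ⟨R, hR0, hR⟩ : ∃ R : ℝ, 0 < R ∧ ∀ x ∈ Ω, ∀ y ∈ Ω, ‖x - y‖ ^ 2 ≤ R := by
    obtain ⟨b, hb⟩ := (hΩ.prod hΩ).exists_bound_of_continuousOn
      (f := fun z : Euc d × Euc d ↦ ‖z.1 - z.2‖ ^ 2) (s := Ω ×ˢ Ω) (by fun_prop)
    refine ⟨max b 1, lt_max_of_lt_right one_pos, fun x hx y hy ↦ ?_⟩
    exact (le_abs_self _).trans ((hb (x, y) ⟨hx, hy⟩).trans (le_max_left _ _))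
  refine le_of_forall_pos_le_add fun e he ↦ ?_
  -- the regularization parameters
  set δ : ℝ := e / 4 / R with hδdef
  have hδ : 0 < δ := by positivity
  obtain ⟨r₁, hr₁, hφr⟩ := Metric.uniformContinuous_iff.1
    (CompactSpace.uniformContinuous_of_continuous φ.continuous) (e / 4) (by positivity)
  -- Four errors of size `e / 4` are allowed. The choice of `δ` makes the cost of replacing time `1`
  -- by `1 + δ` at most `δ R = e / 4`. On the scale `r`, `φ` varies by less than `e / 4`, and `r ≤
  -- 1` with `r ≤ e δ / 4` gives `r² / δ ≤ e / 4`. The last error is `ε log (card s')`.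
  set r : ℝ := min r₁ (min 1 (e / 4 * δ)) with hrdef
  have hr : 0 < r := by positivity
  obtain ⟨s, -, hsf, hscov⟩ := (isCompact_univ (X := Ω)).finite_cover_balls hr
  let s' : Finset (Euc d) := hsf.toFinset.image Subtype.val
  have hs' : s'.Nonempty := by
    obtain ⟨x⟩ := hΩne
    obtain ⟨y, hy, -⟩ := mem_iUnion₂.1 (hscov (mem_univ x))
    exact ⟨y, Finset.mem_image_of_mem _ (hsf.mem_toFinset.2 hy)⟩
  have hs'Ω : ∀ y ∈ s', y ∈ Ω := fun y hy ↦ by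
    obtain ⟨z, -, rfl⟩ := Finset.mem_image.1 hy
    exact z.2
  -- With initial datum `-φ`, admissibility of the pair says that the Hopf–Lax function at time one
  -- dominates `ψ`, up to the errors. The value zero outside `Ω` is never used, because the net lies
  -- in `Ω`.
  let f : Euc d → ℝ := Function.extend Subtype.val (fun x : Ω ↦ -φ x) 0
  have hf : ∀ x : Ω, f x = -φ x := fun x ↦ Subtype.val_injective.extend_apply _ _ x
  obtain ⟨ε, hε, hεle⟩ : ∃ ε : ℝ, 0 < ε ∧ ε * Real.log s'.card ≤ e / 4 := by
    have hl : 0 ≤ Real.log s'.card := Real.log_natCast_nonneg _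
    refine ⟨e / 4 / (1 + Real.log s'.card), by positivity, ?_⟩
    rw [div_mul_eq_mul_div, div_le_iff₀ (by positivity)]
    nlinarith
  obtain ⟨τ, hτ, hτ0, hτδ⟩ := exists_smooth_shift hδ
  have hu := contDiff_hopfLax (ε := ε) (f := f) hs' hτ hτ0
  have key := integral_sub_le_of_subsolution hΩ hprob hρΩ hlip hv hfin hu
    fun t ht x p ↦ fderiv_hopfLax_le hε hδ hs' hτ hτ0 hτδ ht.1 x p
  -- comparison at the final time
  have hψ : ∀ y : Ω, ψ y ≤ hopfLax ε s' f τ (1, y) + e / 2 := by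
    intro y
    have h1 : ∀ z ∈ s', ψ y - e / 4 ≤ f z + ‖(y : Euc d) - z‖ ^ 2 / τ 1 := by
      intro z hz
      have h2 := hφψ ⟨z, hs'Ω z hz⟩ y
      have h3 := hf ⟨z, hs'Ω z hz⟩
      have h4 := hR y y.2 z (hs'Ω z hz)
      simp only at h2 h3
      rw [norm_sub_rev] at h2
      rw [hτδ 1 zero_le_one, h3]
      have h5 : ‖(y : Euc d) - z‖ ^ 2 - e / 4 ≤ ‖(y : Euc d) - z‖ ^ 2 / (1 + δ) := by
        rw [le_div_iff₀ (by positivity)]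
        have h6 : δ * R = e / 4 := by rw [hδdef]; field_simp
        nlinarith [mul_le_mul_of_nonneg_left h4 hδ.le, mul_pos he hδ]
      linarith
    have h7 := le_softMin hε hs' h1
    simp only [hopfLax]
    linarith
  -- comparison at the initial time
  have hφ0 : ∀ x : Ω, hopfLax ε s' f τ (0, x) ≤ -φ x + e / 2 := by
    intro x
    obtain ⟨y, hy, hxy⟩ := mem_iUnion₂.1 (hscov (mem_univ x))
    have hys : (y : Euc d) ∈ s' := Finset.mem_image_of_mem _ (hsf.mem_toFinset.2 hy)
    have h1 := softMin_le (a := fun z ↦ f z + ‖(x : Euc d) - z‖ ^ 2 / τ 0) hε hys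
    have hd : dist x y < r := hxy
    have h2 := hφr (hd.trans_le (min_le_left _ _))
    rw [Real.dist_eq] at h2
    have h3 := (abs_lt.1 h2).2
    have h4 : ‖(x : Euc d) - y‖ < r := by rwa [← dist_eq_norm]
    have h5 : ‖(x : Euc d) - y‖ ^ 2 / τ 0 ≤ e / 4 := by
      rw [hτδ 0 le_rfl, zero_add, div_le_iff₀ hδ]
      have h6 : r ≤ 1 := (min_le_right _ _).trans (min_le_left _ _)
      have h7 : r ≤ e / 4 * δ := (min_le_right _ _).trans (min_le_right _ _)
      nlinarith [norm_nonneg ((x : Euc d) - y)]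
    simp only [hf] at h1
    simp only [hopfLax]
    linarith
  have hres : ∀ t ∈ Icc (0 : ℝ) 1, (ρ t).restrict Ω = ρ t := fun t ht ↦
    Measure.restrict_eq_self_of_ae_mem (hρΩ t ht)
  have hcprob : ∀ t ∈ Icc (0 : ℝ) 1,
      IsProbabilityMeasure ((ρ t).comap (Subtype.val : Ω → Euc d)) := fun t ht ↦ by
    have := hprob t ht
    constructor
    rw [comap_subtype_coe_apply hΩm, image_univ, Subtype.range_coe]
    exact (prob_compl_eq_zero_iff hΩm).1 (hρΩ t ht)
  have := hcprob 0 h0mem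
  have := hcprob 1 h1mem
  have hintegral : ∀ t : ℝ, ∃ g : C(Ω, ℝ), ∀ x : Ω, g x = hopfLax ε s' f τ (t, x) := fun t ↦
    ⟨⟨fun x : Ω ↦ hopfLax ε s' f τ (t, x), hu.continuous.comp (by fun_prop)⟩, fun _ ↦ rfl⟩
  obtain ⟨g0, hg0⟩ := hintegral 0
  obtain ⟨g1, hg1⟩ := hintegral 1
  have e1 : ∫ y, ψ y ∂((ρ 1).comap Subtype.val) ≤
      ∫ x, hopfLax ε s' f τ (1, x) ∂(ρ 1) + e / 2 := by
    rw [← hres 1 h1mem, ← integral_subtype_comap hΩm, hres 1 h1mem]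
    calc _ ≤ ∫ y : Ω, (g1 y + e / 2) ∂((ρ 1).comap Subtype.val) :=
          integral_mono (integrable_continuousMap ψ)
            ((integrable_continuousMap g1).add (integrable_const _))
            fun y ↦ by rw [hg1]; exact hψ y
      _ = _ := by
          rw [integral_add (integrable_continuousMap g1) (integrable_const _)]
          simp [hg1]
  have e0 : ∫ x, hopfLax ε s' f τ (0, x) ∂(ρ 0) ≤
      -∫ x, φ x ∂((ρ 0).comap Subtype.val) + e / 2 := by
    rw [← hres 0 h0mem, ← integral_subtype_comap hΩm, hres 0 h0mem]
    calc _ ≤ ∫ x : Ω, (-φ x + e / 2) ∂((ρ 0).comap Subtype.val) := by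
          simp only [← hg0]
          exact integral_mono (integrable_continuousMap g0)
            ((integrable_continuousMap φ).neg.add (integrable_const _))
            fun y ↦ by rw [hg0]; exact hφ0 y
      _ = _ := by
          have hneg : Integrable (fun x : Ω ↦ -φ x) ((ρ 0).comap Subtype.val) :=
            (integrable_continuousMap φ).neg
          rw [integral_add hneg (integrable_const _), integral_neg]
          simp
  linarith

end LowerBound

/-! ### Almost optimality of perturbed small gradient maps -/

section GradientTransport

variable {d : ℕ} {f : Euc d → ℝ} {g : Euc d → Euc d}

theorem add_inner_sub_le_of_gradient {K : ℝ} (hf : ∀ x, HasGradientAt f (g x) x)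
    (hg : ∀ x y, ‖g x - g y‖ ≤ K * ‖x - y‖) (hK : 0 ≤ K) (x z : Euc d) :
    f x + inner ℝ (g x) (z - x) - K * ‖z - x‖ ^ 2 ≤ f z := by
  have h1 := (convex_segment x z).norm_image_sub_le_of_norm_hasFDerivWithin_le' (𝕜 := ℝ)
    (f := f) (f' := fun y ↦ InnerProductSpace.toDual ℝ (Euc d) (g y))
    (φ := InnerProductSpace.toDual ℝ (Euc d) (g x)) (C := K * ‖z - x‖)
    (fun y _ ↦ ((hf y).hasFDerivAt).hasFDerivWithinAt) (fun y hy ↦ ?_)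
    (left_mem_segment ℝ x z) (right_mem_segment ℝ x z)
  · rw [InnerProductSpace.toDual_apply_apply, Real.norm_eq_abs] at h1
    have := (abs_le.1 h1).1
    nlinarith
  · rw [← map_sub, LinearIsometryEquiv.norm_map]
    refine (hg y x).trans ?_
    gcongr
    obtain ⟨s, hs, rfl⟩ := (segment_eq_image' ℝ x z).subset hy
    rw [add_sub_cancel_left, norm_smul, Real.norm_of_nonneg hs.1]
    exact mul_le_of_le_one_left (norm_nonneg _) hs.2

/-- Write `y = x + g x + r` and `u = z - x`. The terms `⟨g x, u⟩` cancel, and `K ≤ 1/4` leaves at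
least `|u|² / 4 - ⟨u, r⟩ = |u/2 - r|² - |r|²`. So `x` almost minimizes the right-hand side over `z`.
-/
theorem add_le_potential_add {K G R : ℝ} (hf : ∀ x, HasGradientAt f (g x) x)
    (hg : ∀ x y, ‖g x - g y‖ ≤ K * ‖x - y‖) (hK : 0 ≤ K) (hK' : K ≤ 1 / 4) {x y : Euc d}
    (hG : ‖g x‖ ≤ G) (hR : ‖y - x - g x‖ ≤ R) (z : Euc d) :
    f x + (‖g x‖ ^ 2 - 2 * G * R - R ^ 2) / 2 ≤ f z + ‖z - y‖ ^ 2 / 2 := by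
  have h1 := add_inner_sub_le_of_gradient hf hg hK x z
  set r := y - x - g x with hr
  set u := z - x with hu
  have h2 : z - y = u - (g x + r) := by rw [hr, hu]; abel
  have h3 : 0 ≤ ‖(1 / 2 : ℝ) • u - r‖ ^ 2 := by positivity
  have h4 : ‖g x‖ * ‖r‖ ≤ G * R :=
    mul_le_mul hG hR (norm_nonneg _) ((norm_nonneg _).trans hG)
  have h5 : ‖r‖ ^ 2 ≤ R ^ 2 := pow_le_pow_left₀ (norm_nonneg _) hR 2
  have h6 := (abs_le.1 (abs_real_inner_le_norm (g x) r)).1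
  have h7 : K * ‖u‖ ^ 2 ≤ 1 / 4 * ‖u‖ ^ 2 := by gcongr
  rw [norm_sub_sq_real, norm_smul, inner_smul_left, Real.norm_of_nonneg (by norm_num)] at h3
  simp only [conj_trivial] at h3
  rw [h2, norm_sub_sq_real, norm_add_sq_real, inner_add_right, real_inner_comm (g x) u]
  nlinarith

/-- A map close to a small gradient perturbation of the identity is an almost optimal transport. -/
theorem ofReal_le_W_sq_of_gradient {K G R : ℝ} (hf : ∀ x, HasGradientAt f (g x) x)
    (hg : ∀ x y, ‖g x - g y‖ ≤ K * ‖x - y‖) (hK : 0 ≤ K) (hK' : K ≤ 1 / 4)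
    (hG : ∀ x, ‖g x‖ ≤ G) {Y : Euc d → Euc d} (hY : Continuous Y)
    (hR : ∀ x, ‖Y x - x - g x‖ ≤ R)
    {Ω : Set (Euc d)} (hΩ : IsCompact Ω) {μ : Measure (Euc d)} [IsProbabilityMeasure μ]
    (hμ : μ Ωᶜ = 0) (hYμ : (μ.map Y) Ωᶜ = 0) :
    ENNReal.ofReal (∫ x, ‖g x‖ ^ 2 ∂μ - 2 * G * R - R ^ 2) ≤ W μ (μ.map Y) ^ 2 := by
  have hfc : Continuous f := continuous_iff_continuousAt.2 fun x ↦ (hf x).continuousAt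
  have hgc : Continuous g :=
    (LipschitzWith.of_dist_le_mul (K := Real.toNNReal K) fun x y ↦ by
      rw [dist_eq_norm, dist_eq_norm, Real.coe_toNNReal _ hK]; exact hg x y).continuous
  have hΩne : Ω.Nonempty := by
    by_contra hne
    rw [not_nonempty_iff_eq_empty] at hne
    rw [hne, compl_empty, measure_univ] at hμ
    exact one_ne_zero hμ
  -- The transform of `f` for the cost `|z - y|² / 2`: the pair `(-f, u)` is admissible by
  -- construction, and weak duality bounds the cost of every coupling from below. The infimum may be
  -- restricted to `Ω` because both marginals are concentrated there.
  let u : Euc d → ℝ := fun y ↦ sInf ((fun z ↦ f z + ‖z - y‖ ^ 2 / 2) '' Ω)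
  have huc : Continuous u := hΩ.continuous_sInf
    (f := fun y z ↦ f z + ‖z - y‖ ^ 2 / 2) (by fun_prop)
  have hu_le : ∀ y, ∀ z ∈ Ω, u y ≤ f z + ‖z - y‖ ^ 2 / 2 := fun y z hz ↦
    csInf_le (hΩ.bddBelow_image (by fun_prop)) (mem_image_of_mem _ hz)
  have hle_u : ∀ x, f x + (‖g x‖ ^ 2 - 2 * G * R - R ^ 2) / 2 ≤ u (Y x) := by
    intro x
    refine le_csInf (hΩne.image _) ?_
    rintro _ ⟨z, -, rfl⟩
    exact add_le_potential_add hf hg hK hK' (hG x) (hR x) z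
  have hbdd : ∀ (κ : Measure (Euc d)) [IsProbabilityMeasure κ], κ Ωᶜ = 0 → ∀ h : Euc d → ℝ,
      Continuous h → Integrable h κ := by
    intro κ _ hκ h hh
    obtain ⟨b, hb⟩ := hΩ.exists_bound_of_continuousOn hh.continuousOn
    refine Integrable.of_bound hh.aestronglyMeasurable b ?_
    have : ∀ᵐ x ∂κ, x ∈ Ω := hκ
    filter_upwards [this] with x hx using hb x hx
  have : IsProbabilityMeasure (μ.map Y) := Measure.isProbabilityMeasure_map hY.aemeasurable
  have hfμ : Integrable f μ := hbdd μ hμ f hfc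
  have huν : Integrable u (μ.map Y) := hbdd _ hYμ u huc
  have huY : Integrable (fun x ↦ u (Y x)) μ := hbdd μ hμ _ (huc.comp hY)
  have hgμ : Integrable (fun x ↦ ‖g x‖ ^ 2) μ := hbdd μ hμ _ (by fun_prop)
  rw [W_sq]
  refine le_iInf₂ fun p hp ↦ ?_
  obtain ⟨hp1, hp2⟩ := hp
  have hp1Ω : ∀ᵐ z ∂p, z.1 ∈ Ω := by
    have h : ∀ᵐ x ∂p.fst, x ∈ Ω := by rw [hp1]; exact hμ
    exact ae_of_ae_map measurable_fst.aemeasurable h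
  have hp2Ω : ∀ᵐ z ∂p, z.2 ∈ Ω := by
    have h : ∀ᵐ x ∂p.snd, x ∈ Ω := by rw [hp2]; exact hYμ
    exact ae_of_ae_map measurable_snd.aemeasurable h
  have hpp : IsProbabilityMeasure p := by
    constructor
    have : μ univ = 1 := measure_univ
    rw [← hp1, Measure.fst_univ] at this
    exact this
  have hcost : Integrable (fun z : Euc d × Euc d ↦ ‖z.1 - z.2‖ ^ 2) p := by
    obtain ⟨b, hb⟩ := (hΩ.prod hΩ).exists_bound_of_continuousOn
      (f := fun z : Euc d × Euc d ↦ ‖z.1 - z.2‖ ^ 2) (s := Ω ×ˢ Ω) (by fun_prop)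
    refine Integrable.of_bound (by fun_prop) b ?_
    filter_upwards [hp1Ω, hp2Ω] with z h1 h2 using hb z ⟨h1, h2⟩
  have hf1 : Integrable (fun z : Euc d × Euc d ↦ f z.1) p :=
    Integrable.comp_measurable (g := f) (by rw [← Measure.fst, hp1]; exact hfμ) measurable_fst
  have hu2 : Integrable (fun z : Euc d × Euc d ↦ u z.2) p :=
    Integrable.comp_measurable (g := u) (by rw [← Measure.snd, hp2]; exact huν) measurable_snd
  have hif : ∫ z, f z.1 ∂p = ∫ x, f x ∂μ := by
    rw [← hp1, Measure.fst, integral_map measurable_fst.aemeasurable hfc.aestronglyMeasurable]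
  have hiu : ∫ z, u z.2 ∂p = ∫ x, u (Y x) ∂μ := by
    rw [← integral_map hY.aemeasurable huc.aestronglyMeasurable, ← hp2, Measure.snd,
      integral_map measurable_snd.aemeasurable huc.aestronglyMeasurable]
  have h1 : ∫ z, (u z.2 - f z.1) ∂p ≤ ∫ z, ‖z.1 - z.2‖ ^ 2 / 2 ∂p := by
    refine integral_mono_ae (hu2.sub hf1) (hcost.div_const 2) ?_
    filter_upwards [hp1Ω] with z hz
    have := hu_le z.2 z.1 hz
    linarith
  have h2 : ∫ x, (f x + (‖g x‖ ^ 2 - 2 * G * R - R ^ 2) / 2) ∂μ ≤ ∫ x, u (Y x) ∂μ :=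
    integral_mono (hfμ.add (((hgμ.sub (integrable_const _)).sub (integrable_const _)).div_const 2))
      huY hle_u
  have h3 : ∫ x, (f x + (‖g x‖ ^ 2 - 2 * G * R - R ^ 2) / 2) ∂μ =
      ∫ x, f x ∂μ + (∫ x, ‖g x‖ ^ 2 ∂μ - 2 * G * R - R ^ 2) / 2 := by
    have hq' : Integrable (fun x ↦ ‖g x‖ ^ 2 - 2 * G * R) μ := hgμ.sub (integrable_const _)
    have hq : Integrable (fun x ↦ (‖g x‖ ^ 2 - 2 * G * R - R ^ 2) / 2) μ :=
      (hq'.sub (integrable_const _)).div_const 2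
    rw [integral_add hfμ hq, integral_div, integral_sub hq' (integrable_const _),
      integral_sub hgμ (integrable_const _)]
    simp
  rw [integral_sub hu2 hf1, hif, hiu, integral_div] at h1
  have h4 : ∫⁻ z, ‖z.1 - z.2‖ₑ ^ 2 ∂p = ENNReal.ofReal (∫ z, ‖z.1 - z.2‖ ^ 2 ∂p) := by
    rw [ofReal_integral_eq_lintegral_ofReal hcost (ae_of_all _ fun z ↦ by positivity)]
    refine lintegral_congr fun z ↦ ?_
    rw [ENNReal.ofReal_pow (norm_nonneg _), ofReal_norm]
  rw [h4]
  apply ENNReal.ofReal_le_ofReal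
  linarith

end GradientTransport

/-! ### Energy of geodesics in the submanifold -/

namespace MainAssumption

variable {d m : ℕ} {M : Type*} [EMetricSpace M] [ChartedSpace (Euc m) M]
    [RiemannianBundle (fun x : M ↦ TangentSpace (𝓡 m) x)]
    {Ω : Set (Euc d)} {S : Set M} {D : ∀ θ : M, Set (TangentSpace (𝓡 m) θ)}
    {E : M → Measure (Euc d)} {B : ∀ θ : M, TangentSpace (𝓡 m) θ →ₗ[ℝ] (Euc d → Euc d)}

/-- The geodesic restriction dominates the Wasserstein distance. -/
theorem W_le_WRestr (h : MainAssumption Ω S D E B) (μ ν : Measure (Euc d)) :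
    W μ ν ≤ WRestr (E '' S) μ ν := by
  refine le_iInf₂ fun ρ hρ ↦ ?_
  rw [← ENNReal.pow_le_pow_left_iff two_ne_zero, rpow_half_sq]
  refine le_iInf₂ fun v hv ↦ ?_
  rw [← hρ.source, ← hρ.target]
  refine W_sq_le_lintegral h.isCompact_domain (fun t ht ↦ ?_) (fun t ht ↦ ?_) hρ.lipschitz hv
  · obtain ⟨θ, hθ, hE⟩ := hρ.mem t ht
    exact hE ▸ h.isProbabilityMeasure θ hθ
  · obtain ⟨θ, hθ, hE⟩ := hρ.mem t ht
    exact hE ▸ h.concentrated θ hθ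

variable [IsRiemannianManifold (𝓡 m) M]

theorem edist_expCurve_le_mul (h : MainAssumption Ω S D E B) {θ : M} (hθ : θ ∈ S)
    {η : TangentSpace (𝓡 m) θ} (hη : η ∈ D θ) {s t : ℝ} (hs : s ∈ Icc (0 : ℝ) 1)
    (ht : t ∈ Icc (0 : ℝ) 1) :
    edist (expCurve θ η s) (expCurve θ η t) ≤ ‖η‖₊ * edist s t := by
  wlog hst : s ≤ t generalizing s t
  · rw [edist_comm, edist_comm s]
    exact this ht hs (le_of_not_ge hst)
  refine (h.edist_expCurve_le hθ hη hs.1 hst ht.2).trans_eq ?_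
  rw [ENNReal.ofReal_mul (norm_nonneg _), edist_comm s, edist_dist, Real.dist_eq,
    abs_of_nonneg (sub_nonneg.2 hst), ofReal_norm]
  rfl

/-- Along the geodesic from `θ` in the direction `η`, the measures are transported by the flow of
the velocity field of the geodesic. -/
theorem exists_flow_expCurve (h : MainAssumption Ω S D E B) {θ : M} (hθ : θ ∈ S)
    {η : TangentSpace (𝓡 m) θ} (hη : η ∈ D θ) {A K : ℝ≥0}
    (hA : ∀ t ∈ Icc (0 : ℝ) 1, ∀ x, ‖velField B (expCurve θ η) t x‖ ≤ A)
    (hA' : ∀ t ∈ Icc (0 : ℝ) 1, ∀ x y,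
      ‖velField B (expCurve θ η) t x - velField B (expCurve θ η) t y‖ ≤ A * ‖x - y‖)
    (hK : ∀ s ∈ Icc (0 : ℝ) 1, ∀ t ∈ Icc (0 : ℝ) 1, ∀ x,
      ‖velField B (expCurve θ η) s x - velField B (expCurve θ η) t x‖ ≤ K * |s - t|) :
    ∃ w Φ : ℝ → Euc d → Euc d, (∀ t ∈ Icc (0 : ℝ) 1, w t = velField B (expCurve θ η) t) ∧
      Continuous (Function.uncurry Φ) ∧ (∀ x, Φ 0 x = x) ∧
      (∀ x, ∀ t ∈ Icc (0 : ℝ) 1,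
        HasDerivWithinAt (fun s ↦ Φ s x) (w t (Φ t x)) (Icc 0 1) t) ∧
      (∀ x, ∀ t ∈ Icc (0 : ℝ) 1, ‖Φ t x - x‖ ≤ A) ∧
      (∀ t ∈ Icc (0 : ℝ) 1, E (expCurve θ η t) = (E θ).map (Φ t)) ∧
      IsContinuityEq (fun t ↦ E (expCurve θ η t)) w := by
  -- Clamping the time gives a field on all of `ℝ` with the same bounds, and the Lipschitz bounds in
  -- space and time make it jointly continuous.
  let w : ℝ → Euc d → Euc d := fun t ↦
    velField B (expCurve θ η) (projIcc (0 : ℝ) 1 zero_le_one t)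
  have hwv : ∀ t ∈ Icc (0 : ℝ) 1, w t = velField B (expCurve θ η) t := fun t ht ↦ by
    simp only [w, projIcc_of_mem zero_le_one ht]
  have hwA : ∀ t x, ‖w t x‖ ≤ A := fun t x ↦ hA _ (projIcc 0 1 zero_le_one t).2 x
  have hwL : ∀ t, LipschitzWith A (w t) := fun t ↦ LipschitzWith.of_dist_le_mul fun x y ↦ by
    rw [dist_eq_norm, dist_eq_norm]
    exact hA' _ (projIcc 0 1 zero_le_one t).2 x y
  have hwt : ∀ x, LipschitzWith K (fun t ↦ w t x) := fun x ↦
    LipschitzWith.of_dist_le_mul fun s t ↦ by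
      have h1 := (LipschitzWith.projIcc (zero_le_one (α := ℝ))).dist_le_mul s t
      rw [dist_eq_norm]
      refine (hK _ (projIcc 0 1 zero_le_one s).2 _ (projIcc 0 1 zero_le_one t).2 x).trans ?_
      rw [NNReal.coe_one, one_mul] at h1
      exact mul_le_mul_of_nonneg_left h1 K.2
  have hwc : Continuous (Function.uncurry w) :=
    continuous_prod_of_continuous_lipschitzWith' _ A hwL fun x ↦ (hwt x).continuous
  obtain ⟨Φ, hΦc, hΦ0, hΦ⟩ := exists_flow hwc hwA hwL
  have h0 : (0 : ℝ) ∈ Icc (0 : ℝ) 1 := ⟨le_rfl, zero_le_one⟩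
  have hflow : IsFlow Ω (velField B (expCurve θ η)) Φ :=
    { continuousOn := fun t _ ↦ (hΦc.comp (by fun_prop : Continuous fun x ↦ (t, x))).continuousOn
      absCont := fun x _ ↦ by
        refine LipschitzOnWith.absolutelyContinuousOnInterval (K := A) ?_
        rw [uIcc_of_le zero_le_one]
        refine LipschitzOnWith.of_dist_le_mul fun s hs t ht ↦ ?_
        rw [dist_eq_norm, dist_eq_norm]
        exact norm_flow_sub_le hwA (hΦ x) ht hs
      initial := fun x _ ↦ hΦ0 x
      ode := by
        rw [← restrict_Ioo_eq_restrict_Icc]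
        filter_upwards [ae_restrict_mem measurableSet_Ioo] with t ht x _
        rw [← hwv t (Ioo_subset_Icc_self ht)]
        exact (hΦ x t (Ioo_subset_Icc_self ht)).hasDerivAt (Icc_mem_nhds ht.1 ht.2) }
  have hE : ∀ t ∈ Icc (0 : ℝ) 1, E (expCurve θ η t) = (E θ).map (Φ t) := by
    intro t ht
    have := h.consistent (expCurve θ η) (h.geodesic_mem θ hθ η hη)
      ⟨‖η‖₊, fun s hs t ht ↦ h.edist_expCurve_le_mul hθ hη hs ht⟩ Φ hflow t ht
    rwa [h.expCurve_zero hθ hη] at this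
  have := h.isProbabilityMeasure θ hθ
  refine ⟨w, Φ, hwv, hΦc, hΦ0, hΦ, fun x t ht ↦ ?_, hE,
    isContinuityEq_of_flow hwc hwA hΦc hΦ h.isCompact_domain (h.concentrated θ hθ) hE⟩
  have h1 := norm_flow_sub_le hwA (hΦ x) h0 ht
  rw [hΦ0, sub_zero, Real.norm_of_nonneg ht.1] at h1
  exact h1.trans (mul_le_of_le_one_right A.2 ht.2)

theorem isLipCurve_expCurve (h : MainAssumption Ω S D E B) {θ : M} (hθ : θ ∈ S)
    {η : TangentSpace (𝓡 m) θ} (hη : η ∈ D θ) :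
    IsLipCurve (E '' S) (E θ) (E (riemExp θ η)) (fun t ↦ E (expCurve θ η t)) := by
  obtain ⟨L, hL⟩ := h.biLipschitz
  refine ⟨fun t ht ↦ mem_image_of_mem _ (h.geodesic_mem θ hθ η hη t ht),
    ⟨L * ‖η‖₊, fun s hs t ht ↦ ?_⟩, by simp only [h.expCurve_zero hθ hη],
    by simp only [expCurve_one]⟩
  refine (hL _ (h.geodesic_mem θ hθ η hη s hs) _ (h.geodesic_mem θ hθ η hη t ht)).1.trans ?_
  rw [ENNReal.coe_mul, mul_assoc]
  gcongr
  exact h.edist_expCurve_le_mul hθ hη hs ht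

theorem WRestr_sq_le (h : MainAssumption Ω S D E B) {θ : M} (hθ : θ ∈ S)
    {η : TangentSpace (𝓡 m) θ} (hη : η ∈ D θ) {w Φ : ℝ → Euc d → Euc d} {Z : ℝ≥0∞}
    (hΦc : Continuous (Function.uncurry Φ))
    (hE : ∀ t ∈ Icc (0 : ℝ) 1, E (expCurve θ η t) = (E θ).map (Φ t))
    (hw : IsContinuityEq (fun t ↦ E (expCurve θ η t)) w)
    (hZ : ∀ t ∈ Icc (0 : ℝ) 1, ∫⁻ x, ‖w t (Φ t x)‖ₑ ^ 2 ∂(E θ) ≤ Z) :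
    WRestr (E '' S) (E θ) (E (riemExp θ η)) ^ 2 ≤ Z := by
  calc WRestr (E '' S) (E θ) (E (riemExp θ η)) ^ 2
      ≤ (energy (fun t ↦ E (expCurve θ η t)) ^ (1 / 2 : ℝ)) ^ 2 := by
        gcongr
        exact iInf₂_le _ (h.isLipCurve_expCurve hθ hη)
    _ = energy (fun t ↦ E (expCurve θ η t)) := rpow_half_sq _
    _ ≤ ∫⁻ t in Icc (0 : ℝ) 1, ∫⁻ x, ‖w t x‖ₑ ^ 2 ∂(E (expCurve θ η t)) := iInf₂_le _ hw
    _ ≤ ∫⁻ _ in Icc (0 : ℝ) 1, Z := by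
        refine setLIntegral_mono measurable_const fun t ht ↦ ?_
        have hwt : Measurable (w t) := hw.measurable.comp measurable_prodMk_left
        have hΦt : Measurable (Φ t) :=
          (hΦc.comp (by fun_prop : Continuous fun x ↦ (t, x))).measurable
        rw [hE t ht, lintegral_map (by fun_prop) hΦt]
        exact hZ t ht
    _ = Z := by simp

variable [IsManifold (𝓡 m) ∞ M]
    [IsContMDiffRiemannianBundle (𝓡 m) ∞ (Euc m) (fun x : M ↦ TangentSpace (𝓡 m) x)]

/-- The energy of a geodesic is bounded by the square of its length and, for short geodesics, it
exceeds the squared Wasserstein distance of the end points by at most the cube of the length. -/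
theorem exists_WRestr_sq_le (h : MainAssumption Ω S D E B) :
    ∃ C : ℝ, 0 < C ∧ ∀ θ ∈ S, ∀ η ∈ D θ,
      WRestr (E '' S) (E θ) (E (riemExp θ η)) ^ 2 ≤ ENNReal.ofReal ((C * ‖η‖) ^ 2) ∧
      (C * ‖η‖ ≤ 1 / 4 → WRestr (E '' S) (E θ) (E (riemExp θ η)) ^ 2 ≤
        W (E θ) (E (riemExp θ η)) ^ 2 + ENNReal.ofReal (C * ‖η‖ ^ 3)) := by
  obtain ⟨C, hC, hb⟩ := h.exists_velField_bounds
  -- The error `2 (C a) R + R²` with `R = (C + C²) a²` occurs once in the upper and once in the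
  -- lower bound, whence the factor two; `a ≤ 1 / (4 C)` turns the `a⁴` in `R²` into `a³`. The
  -- summand `C` serves the crude bound and the smallness condition.
  refine ⟨C + 2 * (2 * C * (C + C ^ 2) + (C + C ^ 2) ^ 2 / (4 * C)), by positivity,
    fun θ hθ η hη ↦ ?_⟩
  set C' : ℝ := C + 2 * (2 * C * (C + C ^ 2) + (C + C ^ 2) ^ 2 / (4 * C)) with hC'
  obtain ⟨hb1, hb2, hb3⟩ := hb θ hθ η hη
  set a : ℝ := ‖η‖
  have ha : 0 ≤ a := norm_nonneg _
  have hCC' : C ≤ C' := by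
    rw [hC']; exact le_add_of_nonneg_right (by positivity)
  obtain ⟨w, Φ, hwv, hΦc, hΦ0, hΦ, hΦA, hE, hw⟩ := h.exists_flow_expCurve hθ hη
    (A := ⟨C * a, by positivity⟩) (K := ⟨C * a ^ 2, by positivity⟩) hb1 hb2 hb3
  replace hΦA : ∀ x, ∀ t ∈ Icc (0 : ℝ) 1, ‖Φ t x - x‖ ≤ C * a := hΦA
  have := h.isProbabilityMeasure θ hθ
  constructor
  · refine h.WRestr_sq_le hθ hη hΦc hE hw fun t ht ↦ ?_
    calc ∫⁻ x, ‖w t (Φ t x)‖ₑ ^ 2 ∂(E θ) ≤ ∫⁻ _, ENNReal.ofReal ((C' * a) ^ 2) ∂(E θ) := by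
          refine lintegral_mono fun x ↦ ?_
          rw [← ofReal_norm, ← ENNReal.ofReal_pow (norm_nonneg _), hwv t ht]
          have := hb1 t ht (Φ t x)
          gcongr
          exact this.trans (by gcongr)
      _ = _ := by simp
  intro hsmall
  set g : Euc d → Euc d := B θ η
  -- The deviation of the velocity from `g x` along a trajectory: `C a²` from the change of the
  -- field in time, `(C a)²` from its Lipschitz constant times the displacement.
  set R : ℝ := (C + C ^ 2) * a ^ 2 with hRdef
  have hR0 : 0 ≤ R := by positivity
  have h0 : (0 : ℝ) ∈ Icc (0 : ℝ) 1 := ⟨le_rfl, zero_le_one⟩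
  have hg0 : velField B (expCurve θ η) 0 = g := h.velField_expCurve_zero hθ hη
  have hgG : ∀ x, ‖g x‖ ≤ C * a := fun x ↦ hg0 ▸ hb1 0 h0 x
  have hwg : ∀ t ∈ Icc (0 : ℝ) 1, ∀ x, ‖w t (Φ t x) - g x‖ ≤ R := by
    intro t ht x
    rw [hwv t ht, ← hg0]
    have h1 := hb2 t ht (Φ t x) x
    have h2 := hb3 t ht 0 h0 x
    rw [sub_zero, abs_of_nonneg ht.1] at h2
    have h3 : C * a * ‖Φ t x - x‖ ≤ C * a * (C * a) := by
      gcongr; exact hΦA x t ht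
    have h4 : C * a ^ 2 * t ≤ C * a ^ 2 := mul_le_of_le_one_right (by positivity) ht.2
    calc _ ≤ _ := norm_sub_le_norm_sub_add_norm_sub _ (velField B (expCurve θ η) t x) _
      _ ≤ R := by rw [hRdef]; linarith
  -- The curve `s ↦ Φ s x - s • g x` has speed at most `R`.
  have hY : ∀ x, ‖Φ 1 x - x - g x‖ ≤ R := by
    intro x
    have := norm_image_sub_le_of_norm_deriv_le_segment_01' (f := fun s ↦ Φ s x - s • g x)
      (f' := fun s ↦ w s (Φ s x) - g x) (C := R)
      (fun s hs ↦ (hΦ x s hs).sub (by simpa using (hasDerivWithinAt_id s _).smul_const (g x)))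
      (fun s hs ↦ hwg s (Ico_subset_Icc_self hs) x)
    simpa [hΦ0, sub_right_comm] using this
  have hgc : Continuous g := (h.contDiff θ hθ η).continuous
  have hgi : Integrable (fun x ↦ ‖g x‖ ^ 2) (E θ) :=
    Integrable.of_bound (hgc.norm.pow 2).aestronglyMeasurable ((C * a) ^ 2)
      (ae_of_all _ fun x ↦ by
        rw [norm_pow, norm_norm]
        exact pow_le_pow_left₀ (norm_nonneg _) (hgG x) 2)
  have hup : WRestr (E '' S) (E θ) (E (riemExp θ η)) ^ 2 ≤
      ENNReal.ofReal (∫ x, ‖g x‖ ^ 2 ∂(E θ) + (2 * (C * a) * R + R ^ 2)) := by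
    refine h.WRestr_sq_le hθ hη hΦc hE hw fun t ht ↦ ?_
    have hintegral : ∫ x, ‖g x‖ ^ 2 ∂(E θ) + (2 * (C * a) * R + R ^ 2) =
        ∫ x, (‖g x‖ ^ 2 + (2 * (C * a) * R + R ^ 2)) ∂(E θ) := by
      rw [integral_add hgi (integrable_const _)]; simp
    have hi : Integrable (fun x ↦ ‖g x‖ ^ 2 + (2 * (C * a) * R + R ^ 2)) (E θ) :=
      hgi.add (integrable_const _)
    rw [hintegral, ofReal_integral_eq_lintegral_ofReal hi
      (ae_of_all _ fun x ↦ by positivity)]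
    refine lintegral_mono fun x ↦ ?_
    rw [← ofReal_norm, ← ENNReal.ofReal_pow (norm_nonneg _)]
    refine ENNReal.ofReal_le_ofReal ?_
    have h1 : ‖w t (Φ t x)‖ ≤ ‖g x‖ + R :=
      (norm_le_norm_add_norm_sub' _ (g x)).trans (by gcongr; exact hwg t ht x)
    have h2 := pow_le_pow_left₀ (norm_nonneg _) h1 2
    have h3 := mul_le_mul_of_nonneg_right (hgG x) hR0
    linarith
  obtain ⟨f, hf⟩ := h.gradient θ hθ η
  have hE1 : E (riemExp θ η) = (E θ).map (Φ 1) := by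
    rw [← hE 1 ⟨zero_le_one, le_rfl⟩, expCurve_one]
  have hlow := ofReal_le_W_sq_of_gradient (μ := E θ) (Y := Φ 1) (g := g) hf
    (fun x y ↦ hg0 ▸ hb2 0 h0 x y) (by positivity)
    ((mul_le_mul_of_nonneg_right hCC' ha).trans hsmall) hgG
    (hΦc.comp (by fun_prop : Continuous fun x ↦ ((1 : ℝ), x))) hY h.isCompact_domain
    (h.concentrated θ hθ) (by
      rw [← hE 1 ⟨zero_le_one, le_rfl⟩]
      exact h.concentrated _ (h.geodesic_mem θ hθ η hη 1 ⟨zero_le_one, le_rfl⟩))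
  rw [← hE1] at hlow
  have hQ : 2 * (2 * (C * a) * R + R ^ 2) ≤ C' * a ^ 3 := by
    have h1 : C * a ≤ 1 / 4 := (mul_le_mul_of_nonneg_right hCC' ha).trans hsmall
    have h2 : R ^ 2 ≤ (C + C ^ 2) ^ 2 / (4 * C) * a ^ 3 := by
      rw [hRdef, div_mul_eq_mul_div, le_div_iff₀ (by positivity)]
      have : 0 ≤ (C + C ^ 2) ^ 2 * a ^ 3 := by positivity
      nlinarith
    have h3 : 0 ≤ C * a ^ 3 := by positivity
    rw [hC', hRdef] at *
    linarith
  calc WRestr (E '' S) (E θ) (E (riemExp θ η)) ^ 2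
      ≤ ENNReal.ofReal ((∫ x, ‖g x‖ ^ 2 ∂(E θ) - 2 * (C * a) * R - R ^ 2) + C' * a ^ 3) :=
        hup.trans (ENNReal.ofReal_le_ofReal (by linarith))
    _ ≤ ENNReal.ofReal (∫ x, ‖g x‖ ^ 2 ∂(E θ) - 2 * (C * a) * R - R ^ 2) +
        ENNReal.ofReal (C' * a ^ 3) := ENNReal.ofReal_add_le
    _ ≤ _ := by gcongr

end MainAssumption

end WassersteinSubmanifold

end

/-! ### From squared distances to the relative error -/

open WassersteinSubmanifold in
theorem mainTheorem4 {d m : ℕ} {M : Type*} [EMetricSpace M] [ChartedSpace (Euc m) M]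
    [IsManifold (𝓡 m) ∞ M] [RiemannianBundle (fun x : M ↦ TangentSpace (𝓡 m) x)]
    [IsContMDiffRiemannianBundle (𝓡 m) ∞ (Euc m) (fun x : M ↦ TangentSpace (𝓡 m) x)]
    [IsRiemannianManifold (𝓡 m) M]
    (Ω : Set (Euc d)) (S : Set M) (D : ∀ θ : M, Set (TangentSpace (𝓡 m) θ))
    (E : M → Measure (Euc d)) (B : ∀ θ : M, TangentSpace (𝓡 m) θ →ₗ[ℝ] (Euc d → Euc d))
    (h : MainAssumption Ω S D E B) :
    ∃ C : ℝ, 0 < C ∧ ∀ μ ∈ E '' S, ∀ ν ∈ E '' S, μ ≠ ν →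
      0 < W μ ν ∧ W μ ν < ⊤ ∧ WRestr (E '' S) μ ν < ⊤ ∧
      0 ≤ ((WRestr (E '' S) μ ν).toReal - (W μ ν).toReal) / (W μ ν).toReal ^ 2 ∧
      ((WRestr (E '' S) μ ν).toReal - (W μ ν).toReal) / (W μ ν).toReal ^ 2 ≤ C := by
  obtain ⟨C, hC, hCb⟩ := h.exists_WRestr_sq_le
  obtain ⟨L, hL⟩ := h.biLipschitz
  have hL0 : (0 : ℝ) ≤ L := L.2
  -- The first summand handles short geodesics, the second long ones; adding one keeps the constant
  -- positive even if `L = 0`.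
  refine ⟨C * L ^ 3 + 4 * C ^ 2 * L ^ 2 + 1, by positivity, ?_⟩
  rintro _ ⟨θ₀, hθ₀, rfl⟩ _ ⟨θ₁, hθ₁, rfl⟩ hne
  obtain ⟨η, hη, rfl⟩ := h.exists_geodesic θ₀ hθ₀ θ₁ hθ₁
  obtain ⟨hlarge, hsmall⟩ := hCb θ₀ hθ₀ η hη
  obtain ⟨hWa, haW⟩ := hL θ₀ hθ₀ _ hθ₁
  have hle := h.W_le_WRestr (E θ₀) (E (riemExp θ₀ η))
  have hdist : 0 < edist θ₀ (riemExp θ₀ η) := edist_pos.2 fun he ↦ hne (congrArg E he)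
  rw [h.minimizing θ₀ hθ₀ η hη] at hWa haW hdist
  generalize WRestr (E '' S) (E θ₀) (E (riemExp θ₀ η)) = e at *
  generalize W (E θ₀) (E (riemExp θ₀ η)) = w at *
  have hwpos : 0 < w := by
    rw [pos_iff_ne_zero]
    rintro rfl
    rw [mul_zero] at haW
    exact hdist.not_ge haW
  have hwtop : w < ⊤ := hWa.trans_lt (ENNReal.mul_lt_top ENNReal.coe_lt_top enorm_lt_top)
  have hetop : e < ⊤ := by
    by_contra htop
    rw [not_lt_top_iff] at htop
    rw [htop] at hlarge
    simp at hlarge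
  refine ⟨hwpos, hwtop, hetop, ?_⟩
  lift w to ℝ≥0 using hwtop.ne
  lift e to ℝ≥0 using hetop.ne
  rw [ENNReal.coe_toReal, ENNReal.coe_toReal]
  have hw0 : (0 : ℝ) < w := by exact_mod_cast hwpos
  have hwe : (w : ℝ) ≤ e := by exact_mod_cast hle
  have ha0 : 0 ≤ ‖η‖ := norm_nonneg _
  have haw : ‖η‖ ≤ L * w := by
    rw [enorm_eq_nnnorm] at haW
    exact_mod_cast haW
  have hl : (e : ℝ) ≤ C * ‖η‖ := by
    rw [← ENNReal.coe_pow, ENNReal.ofReal, ENNReal.coe_le_coe, ← NNReal.coe_le_coe,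
      Real.coe_toNNReal _ (by positivity), NNReal.coe_pow] at hlarge
    exact le_of_sq_le_sq hlarge (by positivity)
  refine ⟨div_nonneg (sub_nonneg.2 hwe) (by positivity), ?_⟩
  rw [div_le_iff₀ (by positivity)]
  rcases le_total (C * ‖η‖) (1 / 4) with hc | hc
  · have hs : (e : ℝ) ^ 2 ≤ (w : ℝ) ^ 2 + C * ‖η‖ ^ 3 := by
      have := hsmall hc
      rw [← ENNReal.coe_pow, ← ENNReal.coe_pow, ENNReal.ofReal, ← ENNReal.coe_add,
        ENNReal.coe_le_coe, ← NNReal.coe_le_coe, NNReal.coe_add,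
        Real.coe_toNNReal _ (by positivity), NNReal.coe_pow, NNReal.coe_pow] at this
      exact this
    have h1 : C * ‖η‖ ^ 3 ≤ C * (L * w) ^ 3 := by gcongr
    -- Since `e² - w² = (e - w)(e + w) ≥ (e - w) w`, the cubic bound loses one power of `w`.
    have h2 : (e - w : ℝ) * w ≤ C * L ^ 3 * w ^ 2 * w := by
      have : (e - w : ℝ) * w ≤ (e - w) * (e + w) :=
        mul_le_mul_of_nonneg_left (by linarith [e.2]) (sub_nonneg.2 hwe)
      linarith
    have h3 := le_of_mul_le_mul_right h2 hw0
    have h4 : (0 : ℝ) ≤ (4 * C ^ 2 * L ^ 2 + 1) * w ^ 2 := by positivity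
    linarith
  · have h1 : C * ‖η‖ ≤ C * (L * w) := by gcongr
    -- For long geodesics `w` is bounded below, so multiplying by this factor turns the linear bound
    -- `e ≤ C L w` into a quadratic one.
    have h2 : 1 ≤ 4 * (C * (L * w)) := by linarith
    have h3 : C * (L * w) * 1 ≤ C * (L * w) * (4 * (C * (L * w))) := by gcongr
    have h4 : (0 : ℝ) ≤ (C * L ^ 3 + 1) * w ^ 2 := by positivity
    linarith
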